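/- A \emph{convex drawing} of a finite graph $G$ places the vertices of $G$ on pairwise different points of a circle in the plane and draws each edge as the straight-line segment between its ends; two different edges cross if their segments have a common point that is not an end of either segment. For an integer $k \ge 0$, the graph $G$ is \emph{outer $k$-planar} if it has a convex drawing in which every edge crosses at most $k$ other edges. A \emph{tree decomposition} of $G$ is a finite tree with a bag (a set of vertices of $G$) at each node, such that every edge of $G$ lies in some bag and, for every vertex $v$ of $G$, the nodes whose bags contain $v$ form a nonempty subtree; its \emph{width} is the largest size of a bag minus one. The \emph{treewidth} $\mathrm{tw}(G)$ is the minimum width of a tree decomposition of $G$. In the game of cops and robber on $G$, $c$ cops choose their initial vertices, then the robber chooses a vertex; in each round first every cop stays or moves to an adjacent vertex, and then the robber stays or moves to an adjacent vertex. All positions are known to both players, several cops may share a vertex, and the cops win if after finitely many rounds a cop is on the robber's vertex. The \emph{cop number} $\mathrm{cop}(G)$ is the minimum $c$ for which $c$ cops can force a win. Theorem. Let $k \ge 0$ be an integer and let $G$ be a finite simple outer $k$-planar graph. Then $$\mathrm{tw}(G) \le 1.5k + 2.$$ If, moreover, $G$ is connected, then $$\mathrm{cop}(G) \le 0.75k +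 2,$$ and, if $k$ is not a multiple of $4$, even $$\mathrm{cop}(G) \le 0.75k + 1.75.$$ -/

import Mathlib

namespace OuterKPlanar

/-! ### Convex drawings and outer `k`-planar graphs -/

/-- A convex drawing of a graph with vertex set `V`: the vertices are placed on pairwise different
points of a circle in the plane `ℂ`. The edges are the straight-line segments between their ends,
so they need not be recorded. -/
structure ConvexDrawing (V : Type*) where
  pos : V → ℂ
  center : ℂ
  radius : ℝ
  radius_pos : 0 < radius
  pos_mem : ∀ v, pos v ∈ Metric.sphere center radius
  pos_injective : Function.Injective pos

/-- Two different edges cross in a convex drawing if the corresponding straight-line segments have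
a common point that is not an end of either of them. -/
def ConvexDrawing.Crosses {V : Type*} (D : ConvexDrawing V) (e f : Sym2 V) : Prop :=
  e ≠ f ∧ ∃ a b c d : V, e = s(a, b) ∧ f = s(c, d) ∧
    (openSegment ℝ (D.pos a) (D.pos b) ∩ openSegment ℝ (D.pos c) (D.pos d)).Nonempty

/-- A convex drawing of `G` is outer `k`-planar if every edge of `G` crosses at most `k` other
edges of `G`. -/
def ConvexDrawing.IsOuterKPlanar {V : Type*} (D : ConvexDrawing V) (G : SimpleGraph V) (k : ℕ) :
    Prop :=
  ∀ e ∈ G.edgeSet, {f ∈ G.edgeSet | D.Crosses e f}.encard ≤ k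

/-- A graph is outer `k`-planar if it has an outer `k`-planar drawing. -/
def IsOuterKPlanar {V : Type*} (G : SimpleGraph V) (k : ℕ) : Prop :=
  ∃ D : ConvexDrawing V, D.IsOuterKPlanar G k

/-! ### Treewidth -/

/-- A tree decomposition of `G`: a finite tree with a bag of vertices of `G` at each node, such
that every edge of `G` lies in some bag and, for every vertex `v` of `G`, the nodes whose bags
contain `v` induce a subtree (a nonempty connected subgraph of the tree). -/
structure TreeDecomposition {V : Type*} (G : SimpleGraph V) where
  ι : Type
  fintypeNodes : Fintype ι
  tree : SimpleGraph ι
  isTree : tree.IsTree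
  bag : ι → Finset V
  edge_mem_bag : ∀ u v, G.Adj u v → ∃ i, u ∈ bag i ∧ v ∈ bag i
  connected_nodes : ∀ v, (tree.induce {i | v ∈ bag i}).Connected

attribute [instance] TreeDecomposition.fintypeNodes

/-- The width is the largest size of a bag minus one (and `0` if all bags are empty, which is
possible only for the graph without vertices). -/
def TreeDecomposition.width {V : Type*} {G : SimpleGraph V} (D : TreeDecomposition G) : ℕ :=
  (Finset.univ.sup fun i => (D.bag i).card) - 1

/-- The treewidth of a finite graph: the minimum width of a tree decomposition. -/
noncomputable def treewidth {V : Type*} (G : SimpleGraph V) : ℕ :=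
  sInf {w | ∃ D : TreeDecomposition G, D.width = w}

/-- The minimum in the definition of treewidth is over a nonempty set. -/
theorem exists_treeDecomposition {V : Type*} [Finite V] (G : SimpleGraph V) :
    {w | ∃ D : TreeDecomposition G, D.width = w}.Nonempty := by
  classical
  have := Fintype.ofFinite V
  refine ⟨_, ⟨Unit, inferInstance, ⊥, SimpleGraph.IsTree.of_subsingleton, fun _ => Finset.univ,
    fun u v _ => ⟨(), by simp⟩, fun v => ?_⟩, rfl⟩
  have : Nonempty ({i | v ∈ (fun _ : Unit => (Finset.univ : Finset V)) i} : Set Unit) :=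
    ⟨⟨(), by simp⟩⟩
  exact SimpleGraph.Connected.mk fun a b => by
    rw [Subsingleton.elim a b]

/-! ### The game of cops and robber -/

/-- A move of `c` cops: each of them stays or goes to an adjacent vertex. -/
def CopsMove {V : Type*} (G : SimpleGraph V) {c : ℕ} (p p' : Fin c → V) : Prop :=
  ∀ i, p' i = p i ∨ G.Adj (p i) (p' i)

/-- `CopsCatch G p r` says that `c` cops at the positions `p`, being the next to move, can force
the capture of a robber at `r` in finitely many rounds. In a round, first all cops move, and the
robber is caught if a cop is then on the robber's vertex; otherwise the robber stays or goes to an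
adjacent vertex. (A robber who goes to a vertex with a cop is caught in the next round, by a cop
who stays.) -/
inductive CopsCatch {V : Type*} (G : SimpleGraph V) {c : ℕ} : (Fin c → V) → V → Prop
  | capture (p p' : Fin c → V) (r : V) (hmove : CopsMove G p p') (i : Fin c) (hi : p' i = r) :
      CopsCatch G p r
  | step (p p' : Fin c → V) (r : V) (hmove : CopsMove G p p')
      (h : ∀ r', r' = r ∨ G.Adj r r' → CopsCatch G p' r') :
      CopsCatch G p r

/-- `c` cops win on `G` if they can choose initial positions such that, whichever initial vertex
the robber then chooses, they can force the capture. -/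
def CopsWin {V : Type*} (G : SimpleGraph V) (c : ℕ) : Prop :=
  ∃ p : Fin c → V, ∀ r, CopsCatch G p r

/-- The cop number of a finite graph: the minimum number of cops that win. -/
noncomputable def copNumber {V : Type*} (G : SimpleGraph V) : ℕ :=
  sInf {c | CopsWin G c}

/-- The minimum in the definition of the cop number is over a nonempty set. -/
theorem exists_copsWin {V : Type*} [Finite V] (G : SimpleGraph V) :
    {c | CopsWin G c}.Nonempty := by
  obtain ⟨n, ⟨e⟩⟩ := Finite.exists_equiv_fin V
  exact ⟨n, e.symm, fun r =>
    .capture _ e.symm r (fun _ => Or.inl rfl) (e r) (e.symm_apply_apply r)⟩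

end OuterKPlanar

namespace OuterKPlanar

/-! ### Chords of a circle -/

/-! Order the vertices by angle around the circle. The edges that cross a chord `ij` then run from
strictly between `i` and `j` to strictly outside, and every edge of `G` is a chord with at most `k`
crossings.

The geometric core is `exists_split`: a chord with at most `k` crossings and some vertex behind it
is a side of a triangle whose other two sides also have at most `k` crossings. Iterating this cuts
the circle into triangles. An edge that passes through a triangle and has no corner as an end
crosses two of its three sides, so there are at most `3k/2` such edges. The three corners and one
end of each such edge form a separator of at most `3k/2 + 3` vertices. Neighbouring triangles may
choose different ends for the edges crossing their common side; `Sweep.exchange` swaps these ends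
one at a time, with at most `k + 3` vertices occupied. The result is a monotone `Sweep` of the whole
graph (`sweep_chord`, `sweep_univ`).

The sweep is used twice. Recording the occupied set at each placement gives a tree decomposition
(`Sweep.exists_partialDecomposition`). In the game, a single cop can guard two vertices of the
separator by shadowing the robber on a shortest path between them through the robber's territory
(`exists_guards_pair`), so half as many cops as occupied vertices, rounded up, suffice
(`Sweep.holds`). -/

/-- Twice the signed area of the triangle with the given corners. -/
def signedArea (x y z : ℂ) : ℝ :=
  (y.re - x.re) * (z.im - x.im) - (z.re - x.re) * (y.im - x.im)

/-- The areas of the four triangles are the coefficients of the affine dependence of `a, b, c, d`: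
`A a + C c = B b + D d` with `A + C = B + D`. Dividing by the common sum writes one point as a
convex combination on either diagonal. -/
theorem openSegment_inter_openSegment_nonempty {a b c d : ℂ}
    (habc : 0 < signedArea a b c) (habd : 0 < signedArea a b d)
    (hacd : 0 < signedArea a c d) (hbcd : 0 < signedArea b c d) :
    (openSegment ℝ a c ∩ openSegment ℝ b d).Nonempty := by
  set A := signedArea b c d with hA
  set B := signedArea a c d with hB
  set C := signedArea a b d with hC
  set D := signedArea a b c with hD
  have hsum : A + C = B + D := by
    simp only [hA, hB, hC, hD, signedArea]; ring
  have hre : A * a.re + C * c.re = B * b.re + D * d.re := by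
    simp only [hA, hB, hC, hD, signedArea]; ring
  have him : A * a.im + C * c.im = B * b.im + D * d.im := by
    simp only [hA, hB, hC, hD, signedArea]; ring
  have hAC : 0 < A + C := by positivity
  have hBD : 0 < B + D := by positivity
  refine ⟨(A / (A + C)) • a + (C / (A + C)) • c,
    ⟨A / (A + C), C / (A + C), by positivity, by positivity, by field_simp, rfl⟩,
    ⟨B / (B + D), D / (B + D), by positivity, by positivity, by field_simp, ?_⟩⟩
  rw [← hsum]
  apply Complex.ext
  · simp only [Complex.add_re, Complex.real_smul, Complex.re_ofReal_mul]
    field_simp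
    linarith
  · simp only [Complex.add_im, Complex.real_smul, Complex.im_ofReal_mul]
    field_simp
    linarith

/-- The area factors as `4 r²` times the sines of the three half-differences of the angles, all of
which lie in `(0, π)`. -/
theorem signedArea_circle_pos {z : ℂ} {x y w r : ℝ} (hr : 0 < r) (hxy : x < y) (hyw : y < w)
    (hw : w < x + 2 * Real.pi) {a b c : ℂ}
    (ha : a = z + r * Complex.exp (x * Complex.I)) (hb : b = z + r * Complex.exp (y * Complex.I))
    (hc : c = z + r * Complex.exp (w * Complex.I)) : 0 < signedArea a b c := by
  have h1 : 0 < Real.sin ((y - x) / 2) := Real.sin_pos_of_pos_of_lt_pi (by linarith) (by linarith)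
  have h2 : 0 < Real.sin ((w - y) / 2) := Real.sin_pos_of_pos_of_lt_pi (by linarith) (by linarith)
  have h3 : 0 < Real.sin ((w - x) / 2) := Real.sin_pos_of_pos_of_lt_pi (by linarith) (by linarith)
  have area : signedArea a b c =
      r ^ 2 * (Real.sin (y - x) + Real.sin (w - y) - Real.sin (w - x)) := by
    subst ha hb hc
    simp only [signedArea, Complex.add_re, Complex.add_im, Complex.re_ofReal_mul,
      Complex.im_ofReal_mul, Complex.exp_ofReal_mul_I_re, Complex.exp_ofReal_mul_I_im,
      Real.sin_sub]
    ring
  have key : Real.sin (y - x) + Real.sin (w - y) - Real.sin (w - x) =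
      4 * Real.sin ((y - x) / 2) * Real.sin ((w - y) / 2) * Real.sin ((w - x) / 2) := by
    have h4 : w - x = 2 * ((y - x) / 2 + (w - y) / 2) := by ring
    have h5 : y - x = 2 * ((y - x) / 2) := by ring
    have h6 : w - y = 2 * ((w - y) / 2) := by ring
    have h7 : (w - x) / 2 = (y - x) / 2 + (w - y) / 2 := by ring
    rw [h7, h4]
    nth_rewrite 1 [h5]
    nth_rewrite 1 [h6]
    generalize (y - x) / 2 = p
    generalize (w - y) / 2 = q
    rw [Real.sin_two_mul, Real.sin_two_mul, Real.sin_two_mul, Real.sin_add, Real.cos_add]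
    linear_combination (-2 * Real.sin q * Real.cos q) * Real.sin_sq_add_cos_sq p +
      (-2 * Real.sin p * Real.cos p) * Real.sin_sq_add_cos_sq q
  rw [area, key]
  positivity

/-- The angle at which a vertex is placed on the circle. -/
noncomputable def ConvexDrawing.angle {V : Type*} (D : ConvexDrawing V) (v : V) : ℝ :=
  (D.pos v - D.center).arg

theorem ConvexDrawing.pos_eq {V : Type*} (D : ConvexDrawing V) (v : V) :
    D.pos v = D.center + D.radius * Complex.exp (D.angle v * Complex.I) := by
  have h := D.pos_mem v
  rw [mem_sphere_iff_norm] at h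
  rw [angle, ← h, Complex.norm_mul_exp_arg_mul_I]
  ring

theorem ConvexDrawing.angle_injective {V : Type*} (D : ConvexDrawing V) :
    Function.Injective D.angle := fun u v h => D.pos_injective <| by
  rw [D.pos_eq u, D.pos_eq v, h]

theorem ConvexDrawing.crosses_of_angle_lt {V : Type*} (D : ConvexDrawing V) {a b c d : V}
    (hab : D.angle a < D.angle b) (hbc : D.angle b < D.angle c) (hcd : D.angle c < D.angle d) :
    (openSegment ℝ (D.pos a) (D.pos c) ∩ openSegment ℝ (D.pos b) (D.pos d)).Nonempty := by
  have hd : D.angle d < D.angle a + 2 * Real.pi := by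
    have h1 : D.angle d ≤ Real.pi := Complex.arg_le_pi _
    have h2 : -Real.pi < D.angle a := Complex.neg_pi_lt_arg _
    linarith
  have area {x y z : V} (hxy : D.angle x < D.angle y) (hyz : D.angle y < D.angle z)
      (hz : D.angle z < D.angle x + 2 * Real.pi) : 0 < signedArea (D.pos x) (D.pos y) (D.pos z) :=
    signedArea_circle_pos D.radius_pos hxy hyz hz (D.pos_eq x) (D.pos_eq y) (D.pos_eq z)
  exact openSegment_inter_openSegment_nonempty (area hab hbc (by linarith))
    (area hab (by linarith) hd) (area (by linarith) hcd hd) (area hbc hcd (by linarith))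
open Set

/-! ### Crossings of chords of a linearly ordered vertex set -/

section Crossings

variable {V : Type*} (G : SimpleGraph V)

/-- The edges of `G` from `S` to `T`, directed. -/
def edgesBetween (S T : Set V) : Set (V × V) :=
  {e | e.1 ∈ S ∧ e.2 ∈ T ∧ G.Adj e.1 e.2}

/-- The number of edges of `G` from `S` to `T`. -/
noncomputable def numEdges (S T : Set V) : ℕ := (edgesBetween G S T).ncard

variable {G}

theorem mk_mem_edgesBetween {S T : Set V} {u v : V} :
    (u, v) ∈ edgesBetween G S T ↔ u ∈ S ∧ v ∈ T ∧ G.Adj u v := Iff.rfl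

theorem numEdges_comm (S T : Set V) : numEdges G S T = numEdges G T S := by
  have : edgesBetween G T S = Prod.swap '' edgesBetween G S T := by
    ext ⟨u, v⟩
    simp only [image_swap_eq_preimage_swap, mem_preimage, Prod.swap_prod_mk, mk_mem_edgesBetween,
      G.adj_comm u v]
    tauto
  rw [numEdges, numEdges, this, ncard_image_of_injective _ Prod.swap_injective]

variable [Finite V]

theorem numEdges_le {S T S' T' : Set V}
    (h : ∀ u ∈ S, ∀ v ∈ T, G.Adj u v → u ∈ S' ∧ v ∈ T') :
    numEdges G S T ≤ numEdges G S' T' :=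
  ncard_le_ncard fun e he => ⟨(h _ he.1 _ he.2.1 he.2.2).1, (h _ he.1 _ he.2.1 he.2.2).2, he.2.2⟩

theorem numEdges_le_add {S T S₁ T₁ S₂ T₂ : Set V}
    (h : ∀ u ∈ S, ∀ v ∈ T, G.Adj u v → u ∈ S₁ ∧ v ∈ T₁ ∨ u ∈ S₂ ∧ v ∈ T₂) :
    numEdges G S T ≤ numEdges G S₁ T₁ + numEdges G S₂ T₂ := by
  refine (ncard_le_ncard (t := edgesBetween G S₁ T₁ ∪ edgesBetween G S₂ T₂) ?_).trans
    (ncard_union_le _ _)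
  rintro ⟨u, v⟩ ⟨hu, hv, huv⟩
  exact (h u hu v hv huv).imp (fun h => ⟨h.1, h.2, huv⟩) (fun h => ⟨h.1, h.2, huv⟩)

theorem add_le_numEdges {S T S₁ T₁ S₂ T₂ : Set V} (hS₁ : S₁ ⊆ S) (hT₁ : T₁ ⊆ T) (hS₂ : S₂ ⊆ S)
    (hT₂ : T₂ ⊆ T) (h : ∀ u v, u ∈ S₁ → v ∈ T₁ → u ∈ S₂ → v ∈ T₂ → False) :
    numEdges G S₁ T₁ + numEdges G S₂ T₂ ≤ numEdges G S T := by
  rw [numEdges, numEdges, ← ncard_union_eq]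
  · refine ncard_le_ncard ?_
    rintro ⟨u, v⟩ (⟨hu, hv, huv⟩ | ⟨hu, hv, huv⟩)
    exacts [⟨hS₁ hu, hT₁ hv, huv⟩, ⟨hS₂ hu, hT₂ hv, huv⟩]
  · rw [disjoint_left]
    rintro ⟨u, v⟩ ⟨hu, hv, -⟩ ⟨hu', hv', -⟩
    exact h u v hu hv hu' hv'

variable [LinearOrder V]

variable (G) in
/-- The number of edges of `G` that cross the chord with ends `i < j`. -/
noncomputable def crossNum (i j : V) : ℕ := numEdges G (Ioo i j) (Icc i j)ᶜ

/-- An inner vertex that halves the edges crossing a chord. -/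
theorem exists_median {i j : V} (hne : (Ioo i j).Nonempty) (O : Set V) :
    ∃ l ∈ Ioo i j, 2 * numEdges G (Ioo i l) O ≤ numEdges G (Ioo i j) O ∧
      2 * numEdges G (Ioo l j) O ≤ numEdges G (Ioo i j) O := by
  obtain ⟨a, ha, hamin⟩ := exists_min_image (Ioo i j) id (toFinite _) hne
  have hA : a ∈ {l | l ∈ Ioo i j ∧ 2 * numEdges G (Ioo i l) O ≤ numEdges G (Ioo i j) O} := by
    refine ⟨ha, ?_⟩
    have : numEdges G (Ioo i a) O ≤ numEdges G (∅ : Set V) O := numEdges_le fun u hu => by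
      exact absurd (hamin u ⟨hu.1, hu.2.trans ha.2⟩) (not_le.2 hu.2)
    have h0 : numEdges G (∅ : Set V) O = 0 := by simp [numEdges, edgesBetween]
    omega
  obtain ⟨l, ⟨hl, hl2⟩, hlmax⟩ := exists_max_image _ id (toFinite _) ⟨a, hA⟩
  refine ⟨l, hl, hl2, ?_⟩
  by_contra! hlt
  have hne' : (Ioo l j).Nonempty := by
    rw [nonempty_iff_ne_empty]
    intro h
    simp [h, numEdges, edgesBetween] at hlt
  obtain ⟨b, hb, hbmin⟩ := exists_min_image (Ioo l j) id (toFinite _) hne'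
  -- As `b` is the next vertex after `l`, the intervals `Ioo i b` and `Ioo l j` are disjoint. If the
  -- second carried more than half of the edges, `b` would still qualify, against the maximality of
  -- `l`.
  have hsum : numEdges G (Ioo i b) O + numEdges G (Ioo l j) O ≤ numEdges G (Ioo i j) O := by
    refine add_le_numEdges (Ioo_subset_Ioo_right hb.2.le) subset_rfl
      (Ioo_subset_Ioo_left hl.1.le) subset_rfl fun u v hu _ hu' _ => ?_
    exact absurd (hbmin u hu') (not_le.2 hu.2)
  have := hlmax b ⟨⟨hl.1.trans hb.1, hb.2⟩, by omega⟩
  exact absurd hb.1 (not_lt.2 this)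

/-- A chord that is crossed by at most `k` edges is the side of a triangle all of whose sides are
crossed by at most `k` edges. -/
theorem exists_split {k : ℕ} (hG : ∀ u v, u < v → G.Adj u v → crossNum G u v ≤ k) {i j : V}
    (hij : crossNum G i j ≤ k) (hne : (Ioo i j).Nonempty) :
    ∃ l ∈ Ioo i j, crossNum G i l ≤ k ∧ crossNum G l j ≤ k := by
  set O : Set V := (Icc i j)ᶜ with hO
  have notO {x : V} (h1 : i ≤ x) (h2 : x ≤ j) : x ∉ O := fun h => h ⟨h1, h2⟩
  obtain ⟨l, hl, hl1, hl2⟩ := exists_median (G := G) hne O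
  have hm : numEdges G (Ioo i j) O ≤ k := hij
  -- comparison of the two parts on either side of the median
  have hleft {p : V} (hip : i < p) (hp : p < l) :
      numEdges G (Ioo i p) O ≤ numEdges G (Ioo p j) O := by
    have h1 : numEdges G (Ioo i p) O ≤ numEdges G (Ioo i l) O :=
      numEdges_le fun u hu v hv _ => ⟨⟨hu.1, hu.2.trans hp⟩, hv⟩
    have h2 : numEdges G (Ioo i j) O ≤ numEdges G (Ioo i l) O + numEdges G (Ioo p j) O :=
      numEdges_le_add fun u hu v hv _ => by
        rcases lt_or_ge u l with h | h
        · exact .inl ⟨⟨hu.1, h⟩, hv⟩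
        · exact .inr ⟨⟨hp.trans_le h, hu.2⟩, hv⟩
    omega
  have hright {q : V} (hq : l < q) (hqj : q < j) :
      numEdges G (Ioo q j) O ≤ numEdges G (Ioo i q) O := by
    have h1 : numEdges G (Ioo q j) O ≤ numEdges G (Ioo l j) O :=
      numEdges_le fun u hu v hv _ => ⟨⟨hq.trans hu.1, hu.2⟩, hv⟩
    have h2 : numEdges G (Ioo i j) O ≤ numEdges G (Ioo i q) O + numEdges G (Ioo l j) O :=
      numEdges_le_add fun u hu v hv _ => by
        rcases lt_or_ge l u with h | h
        · exact .inr ⟨⟨h, hu.2⟩, hv⟩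
        · exact .inl ⟨⟨hu.1, h.trans_lt hq⟩, hv⟩
    omega
  -- the edges that pass over the median
  let arcs : Set (V × V) := {e | i ≤ e.1 ∧ e.1 < l ∧ l < e.2 ∧ e.2 ≤ j ∧ G.Adj e.1 e.2 ∧
    (i < e.1 ∨ e.2 < j)}
  rcases arcs.eq_empty_or_nonempty with harcs | ⟨e₀, he₀⟩
  · have harc {u v : V} (h1 : i ≤ u) (h2 : u < l) (h3 : l < v) (h4 : v ≤ j) (h5 : G.Adj u v)
        (h6 : i < u ∨ v < j) : False := by
      have : (u, v) ∈ arcs := ⟨h1, h2, h3, h4, h5, h6⟩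
      simp [harcs] at this
    refine ⟨l, hl, le_trans ?_ hm, le_trans ?_ hm⟩
    · refine numEdges_le fun u hu v hv huv => ⟨⟨hu.1, hu.2.trans hl.2⟩, fun h => ?_⟩
      have hlv : l < v := by
        by_contra! h'
        exact hv ⟨h.1, h'⟩
      exact harc hu.1.le hu.2 hlv h.2 huv (.inl hu.1)
    · refine numEdges_le fun u hu v hv huv => ⟨⟨hl.1.trans hu.1, hu.2⟩, fun h => ?_⟩
      have hlv : v < l := by
        by_contra! h'
        exact hv ⟨h', h.2⟩
      exact harc h.1 hlv hu.1 hu.2.le huv.symm (.inr hu.2)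
  -- Take the arc with leftmost left end `p` and, among those, rightmost right end `q`. The last
  -- clause of `arcs` excludes `ij` itself, so at least one of `p`, `q` is a proper inner vertex.
  obtain ⟨⟨p, q₀⟩, hpq₀, hpmin⟩ := exists_min_image arcs Prod.fst (toFinite _) ⟨e₀, he₀⟩
  obtain ⟨q, hpq, hqmax⟩ := exists_max_image {v | (p, v) ∈ arcs} id (toFinite _) ⟨q₀, hpq₀⟩
  obtain ⟨hip, hpl, hlq, hqj, hadj, hor⟩ := hpq
  simp only at hip hpl hlq hqj hadj hor
  have hpk := hG p q (hpl.trans hlq) hadj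
  -- maximality of the arc
  have maxl {u v : V} (h1 : i ≤ u) (h2 : u < p) (h3 : l < v) (h4 : v ≤ j) (h5 : G.Adj u v)
      (h6 : i < u ∨ v < j) : False :=
    not_le.2 h2 (hpmin (u, v) ⟨h1, h2.trans hpl, h3, h4, h5, h6⟩)
  have maxr {v : V} (h3 : q < v) (h4 : v ≤ j) (h5 : G.Adj p v)
      (h6 : i < p ∨ v < j) : False :=
    not_le.2 h3 (hqmax v ⟨hip, hpl, hlq.trans h3, h4, h5, h6⟩)
  rcases hip.eq_or_lt with rfl | hip
  · have hqj : q < j := hor.resolve_left (lt_irrefl _)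
    -- The edge `iq` is one new side. In the count for `qj`, the edges to `O` are outnumbered by
    -- those from `Ioo i q` to `O`, by the choice of the median; after this replacement only
    -- crossings of `iq` are counted.
    refine ⟨q, ⟨hl.1.trans hlq, hqj⟩, hpk, ?_⟩
    have h1 : crossNum G q j ≤ numEdges G (Ioo q j) (Ioo i q) + numEdges G (Ioo q j) O := by
      refine numEdges_le_add fun u hu v hv huv => ?_
      by_cases hvO : v ∈ O
      · exact .inr ⟨hu, hvO⟩
      · simp only [hO, mem_compl_iff, not_not] at hvO
        have hvq : v < q := by
          by_contra! h
          exact hv ⟨h, hvO.2⟩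
        rcases hvO.1.eq_or_lt with rfl | h
        · exact (maxr hu.1 hu.2.le huv.symm (.inr hu.2)).elim
        · exact .inl ⟨hu, h, hvq⟩
    have h2 : numEdges G (Ioo i q) (Ioo q j) + numEdges G (Ioo i q) O ≤ crossNum G i q := by
      refine add_le_numEdges subset_rfl (fun x hx h => not_lt.2 h.2 hx.1) subset_rfl
        (fun x hx h => hx ⟨h.1, h.2.trans hqj.le⟩) fun u v hu hv _ hv' =>
          notO ((hl.1.trans hlq).trans hv.1).le hv.2.le hv'
    rw [numEdges_comm] at h2
    have := hright hlq hqj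
    omega
  rcases hqj.eq_or_lt with rfl | hqj
  · refine ⟨p, ⟨hip, hpl.trans hl.2⟩, ?_, hpk⟩
    have h1 : crossNum G i p ≤ numEdges G (Ioo i p) (Ioo p q) + numEdges G (Ioo i p) O := by
      refine numEdges_le_add fun u hu v hv huv => ?_
      by_cases hvO : v ∈ O
      · exact .inr ⟨hu, hvO⟩
      · simp only [hO, mem_compl_iff, not_not] at hvO
        have hvp : p < v := by
          by_contra! h
          exact hv ⟨hvO.1, h⟩
        rcases hvO.2.eq_or_lt with rfl | h
        · exact (maxl hu.1.le hu.2 hlq le_rfl huv (.inl hu.1)).elim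
        · exact .inl ⟨hu, hvp, h⟩
    have h2 : numEdges G (Ioo p q) (Ioo i p) + numEdges G (Ioo p q) O ≤ crossNum G p q := by
      refine add_le_numEdges subset_rfl (fun x hx h => not_lt.2 h.1 hx.2) subset_rfl
        (fun x hx h => hx ⟨hip.le.trans h.1, h.2⟩) fun u v hu hv _ hv' =>
          notO hv.1.le (hv.2.trans (hpl.trans hlq)).le hv'
    rw [numEdges_comm] at h2
    have := hleft hip hpl
    omega
  -- the arc has both ends inside
  have hpj : p < j := hpl.trans hl.2
  have hiq : i < q := hl.1.trans hlq
  have hpq : p < q := hpl.trans hlq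
  have c1 : crossNum G p j ≤ numEdges G (Ioo p q) (Ico i p) + numEdges G (Ioo p j) O := by
    refine numEdges_le_add fun u hu v hv huv => ?_
    by_cases hvO : v ∈ O
    · exact .inr ⟨hu, hvO⟩
    · simp only [hO, mem_compl_iff, not_not] at hvO
      have hvp : v < p := by
        by_contra! h
        exact hv ⟨h, hvO.2⟩
      refine .inl ⟨⟨hu.1, ?_⟩, hvO.1, hvp⟩
      by_contra! h
      exact maxl hvO.1 hvp (hlq.trans_le h) hu.2.le huv.symm (.inr hu.2)
  have c2 : crossNum G i p ≤ numEdges G (Ioo p q) (Ico i p) + numEdges G (Ioo i p) O := by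
    rw [numEdges_comm (Ioo p q)]
    refine numEdges_le_add fun u hu v hv huv => ?_
    by_cases hvO : v ∈ O
    · exact .inr ⟨hu, hvO⟩
    · simp only [hO, mem_compl_iff, not_not] at hvO
      have hvp : p < v := by
        by_contra! h
        exact hv ⟨hvO.1, h⟩
      refine .inl ⟨⟨hu.1.le, hu.2⟩, hvp, ?_⟩
      by_contra! h
      exact maxl hu.1.le hu.2 (hlq.trans_le h) hvO.2 huv (.inl hu.1)
  have c3 : crossNum G i q ≤ numEdges G (Ioo p q) (Ioc q j) + numEdges G (Ioo i q) O := by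
    refine numEdges_le_add fun u hu v hv huv => ?_
    by_cases hvO : v ∈ O
    · exact .inr ⟨hu, hvO⟩
    · simp only [hO, mem_compl_iff, not_not] at hvO
      have hvq : q < v := by
        by_contra! h
        exact hv ⟨hvO.1, h⟩
      refine .inl ⟨⟨?_, hu.2⟩, hvq, hvO.2⟩
      by_contra! h
      rcases h.eq_or_lt with rfl | h
      · exact maxr hvq hvO.2 huv (.inl hip)
      · exact maxl hu.1.le h (hlq.trans hvq) hvO.2 huv (.inl hu.1)
  have c4 : crossNum G q j ≤ numEdges G (Ioo p q) (Ioc q j) + numEdges G (Ioo q j) O := by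
    rw [numEdges_comm (Ioo p q)]
    refine numEdges_le_add fun u hu v hv huv => ?_
    by_cases hvO : v ∈ O
    · exact .inr ⟨hu, hvO⟩
    · simp only [hO, mem_compl_iff, not_not] at hvO
      have hvq : v < q := by
        by_contra! h
        exact hv ⟨h, hvO.2⟩
      refine .inl ⟨⟨hu.1, hu.2.le⟩, ?_, hvq⟩
      by_contra! h
      rcases h.eq_or_lt with rfl | h
      · exact maxr hu.1 hu.2.le huv.symm (.inl hip)
      · exact maxl hvO.1 h (hlq.trans hu.1) hu.2.le huv.symm (.inr hu.2)
  have c5 : numEdges G (Ioo p q) (Ico i p) + numEdges G (Ioo p q) (Ioc q j) +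
      numEdges G (Ioo p q) O ≤ crossNum G p q := by
    have h1 : numEdges G (Ioo p q) (Ico i p) + numEdges G (Ioo p q) (Ioc q j) ≤
        numEdges G (Ioo p q) (Icc i j \ Icc p q) := by
      refine add_le_numEdges subset_rfl
        (fun x hx => ⟨⟨hx.1, (hx.2.trans hpj).le⟩, fun h => not_lt.2 h.1 hx.2⟩) subset_rfl
        (fun x hx => ⟨⟨(hiq.trans hx.1).le, hx.2⟩, fun h => not_lt.2 h.2 hx.1⟩)
        fun u v _ hv _ hv' => lt_asymm (hv.2.trans hpq) hv'.1
    have h2 : numEdges G (Ioo p q) (Icc i j \ Icc p q) + numEdges G (Ioo p q) O ≤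
        crossNum G p q :=
      add_le_numEdges subset_rfl (fun x hx => hx.2) subset_rfl
        (fun x hx h => hx ⟨hip.le.trans h.1, h.2.trans hqj.le⟩) fun u v _ hv _ hv' => hv' hv.1
    omega
  have c6 : numEdges G (Ioo p j) O + numEdges G (Ioo i q) O ≤
      numEdges G (Ioo i j) O + numEdges G (Ioo p q) O := by
    have h1 : numEdges G (Ioo p j) O ≤ numEdges G (Ioo p q) O + numEdges G (Ico q j) O :=
      numEdges_le_add fun u hu v hv _ => by
        rcases lt_or_ge u q with h | h
        · exact .inl ⟨⟨hu.1, h⟩, hv⟩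
        · exact .inr ⟨⟨h, hu.2⟩, hv⟩
    have h2 : numEdges G (Ioo i q) O + numEdges G (Ico q j) O ≤ numEdges G (Ioo i j) O :=
      add_le_numEdges (Ioo_subset_Ioo_right hqj.le) subset_rfl
        (fun x hx => ⟨hiq.trans_le hx.1, hx.2⟩) subset_rfl
        fun u v hu _ hu' _ => not_le.2 hu.2 hu'.1
    omega
  -- Let `α` and `β` be the right-hand sides of `c1` and `c3`. By `c5` and `c6`, `α + β` is at most
  -- the crossings of `pq` plus those of `ij`, hence at most `2k`. By the median property, `α`
  -- bounds both sides at `p` and `β` both sides at `q`, so `p` or `q` works.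
  have hl' := hleft hip hpl
  have hr' := hright hlq hqj
  rcases le_or_gt (crossNum G p j) k with h | h
  · by_cases h' : crossNum G i p ≤ k
    · exact ⟨p, ⟨hip, hpj⟩, h', h⟩
    · exact ⟨q, ⟨hiq, hqj⟩, by omega, by omega⟩
  · exact ⟨q, ⟨hiq, hqj⟩, by omega, by omega⟩

end Crossings
/-! ### Monotone sweeps of a graph -/

section Sweep

variable {V : Type*}

/-- `Sweep G s X C` says that the territory `C`, which is separated from the rest of `G` by `X`, can
be swept by searchers that occupy at most `s` vertices at any time and start on `X`. -/
inductive Sweep (G : SimpleGraph V) (s : ℕ) : Set V → Set V → Prop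
  | nil (X : Set V) : Sweep G s X ∅
  | join {X C₁ C₂ : Set V} (hC : Disjoint C₁ C₂) (hadj : ∀ u ∈ C₁, ∀ v ∈ C₂, ¬ G.Adj u v)
      (h₁ : Sweep G s X C₁) (h₂ : Sweep G s X C₂) : Sweep G s X (C₁ ∪ C₂)
  | forget {X X' C : Set V} (hX : X' ⊆ X) (hadj : ∀ x ∈ X, x ∉ X' → ∀ y ∈ C, ¬ G.Adj x y)
      (h : Sweep G s X' C) : Sweep G s X C
  | place {X C : Set V} (w : V) (hw : w ∈ C) (hs : X.ncard + 1 ≤ s)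
      (h : Sweep G s (insert w X) (C \ {w})) : Sweep G s X C

variable [Finite V] {G : SimpleGraph V} {s k : ℕ}

theorem Sweep.place_of_subset {X C Y : Set V} (hXC : Disjoint X C) (hY : Y ⊆ C)
    (hs : (X ∪ Y).ncard ≤ s) (h : Sweep G s (X ∪ Y) (C \ Y)) : Sweep G s X C := by
  induction Y, toFinite Y using Set.Finite.induction_on with
  | empty => simpa using h
  | @insert w Y hwY _ ih =>
    rw [union_insert] at h hs
    have hw : w ∉ X ∪ Y := by
      rintro (hw | hw)
      · exact disjoint_left.1 hXC hw (hY (mem_insert _ _))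
      · exact hwY hw
    rw [ncard_insert_of_notMem hw] at hs
    refine ih ((subset_insert _ _).trans hY) (by omega) (.place w ⟨hY (mem_insert _ _), hwY⟩ hs ?_)
    rwa [sdiff_sdiff, union_singleton]

variable [LinearOrder V]

variable (G) in
/-- The edges of `G` that cross the chord with ends `i < j`, directed away from the inner end. -/
def crossings (i j : V) : Set (V × V) := edgesBetween G (Ioo i j) (Icc i j)ᶜ

/-- In a sweep that starts from a chord, the ends that guard the crossing edges can be exchanged
one by one. -/
theorem Sweep.exchange {i j : V} (hs : crossNum G i j + 3 ≤ s)
    (h : Sweep G s ({i, j} ∪ Prod.fst '' crossings G i j) (Ioo i j \ Prod.fst '' crossings G i j))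
    (f : V × V → V) (hf : ∀ e ∈ crossings G i j, f e = e.1 ∨ f e = e.2) :
    Sweep G s ({i, j} ∪ f '' crossings G i j) (Ioo i j \ f '' crossings G i j) := by
  -- Induction on the number of edges guarded at their outer end; `f'` moves the guard of one such
  -- edge `e` to its inner end.
  induction hn : {e ∈ crossings G i j | f e ≠ e.1}.ncard generalizing f with
  | zero =>
    rw [ncard_eq_zero, eq_empty_iff_forall_notMem] at hn
    have : f '' crossings G i j = Prod.fst '' crossings G i j := image_congr fun e he => by
      by_contra hne
      exact hn e ⟨he, hne⟩
    rwa [this]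
  | succ n ih =>
    obtain ⟨e, he, hfe⟩ : {e ∈ crossings G i j | f e ≠ e.1}.Nonempty := by
      rw [← ncard_pos]; omega
    have hfe2 : f e = e.2 := (hf e he).resolve_left hfe
    classical
    let f' := Function.update f e e.1
    have hf'e : f' e = e.1 := Function.update_self ..
    have hf'ne {e' : V × V} (h : e' ≠ e) : f' e' = f e' := Function.update_of_ne h ..
    have hsweep := ih f' (fun e' he' => by
        rcases eq_or_ne e' e with rfl | hne
        · exact .inl hf'e
        · rw [hf'ne hne]; exact hf e' he') (by
      have : {e' ∈ crossings G i j | f' e' ≠ e'.1} = {e ∈ crossings G i j | f e ≠ e.1} \ {e} := by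
        ext e'
        rcases eq_or_ne e' e with rfl | hne
        · simp [hf'e]
        · simp [hf'ne hne, hne]
      rw [this, ncard_sdiff_singleton_of_mem
        (show e ∈ {e ∈ crossings G i j | f e ≠ e.1} from ⟨he, hfe⟩), hn]
      rfl)
    -- Two chord ends, one guard per crossing edge, and one spare while both ends of `e` are
    -- occupied: this is the `+ 3`.
    have hX : ({i, j} ∪ f '' crossings G i j).ncard + 1 ≤ s := by
      have h1 := ncard_union_le {i, j} (f '' crossings G i j)
      have h2 := ncard_insert_le i {j}
      have h3 : (f '' crossings G i j).ncard ≤ (crossings G i j).ncard :=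
        ncard_image_le (toFinite _)
      have h4 : crossNum G i j = (crossings G i j).ncard := rfl
      rw [ncard_singleton] at h2
      omega
    have hC : Ioo i j \ f' '' crossings G i j = (Ioo i j \ f '' crossings G i j) \ {e.1} := by
      ext z
      simp only [mem_sdiff, mem_image, mem_singleton_iff, not_exists, not_and]
      constructor
      · rintro ⟨hz, hzf⟩
        refine ⟨⟨hz, fun e' he' heq => ?_⟩, fun heq => hzf e he (hf'e.trans heq.symm)⟩
        rcases eq_or_ne e' e with rfl | hne
        · rw [hfe2] at heq
          subst heq
          exact he.2.1 (Ioo_subset_Icc_self hz)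
        · exact hzf e' he' (by rw [hf'ne hne, heq])
      · rintro ⟨⟨hz, hzf⟩, hne⟩
        refine ⟨hz, fun e' he' heq => ?_⟩
        rcases eq_or_ne e' e with rfl | hne'
        · exact hne (by rw [← heq, hf'e])
        · exact hzf e' he' (by rw [← heq, hf'ne hne'])
    have hswap : Sweep G s (insert e.1 ({i, j} ∪ f '' crossings G i j))
        ((Ioo i j \ f '' crossings G i j) \ {e.1}) := by
      rw [← hC]
      refine .forget ?_ ?_ hsweep
      · rintro x (hx | ⟨e', he', rfl⟩)
        · exact .inr (.inl hx)
        · rcases eq_or_ne e' e with rfl | hne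
          · rw [hf'e]; exact .inl rfl
          · rw [hf'ne hne]; exact .inr (.inr ⟨e', he', rfl⟩)
      · intro x hx hx' y hy hxy
        rw [hC] at hy
        rcases hx with rfl | hx | ⟨e', he', rfl⟩
        · exact hx' (.inr ⟨e, he, hf'e⟩)
        · exact hx' (.inl hx)
        rcases eq_or_ne e' e with rfl | hne
        · rw [hfe2] at hx' hxy
          -- The outer end may be released: any edge from it into the unswept part would itself be a
          -- crossing edge, guarded at one of its ends. The inner end is unoccupied, so the outer
          -- end would still be in use.
          have hmem : (y, e'.2) ∈ crossings G i j := ⟨hy.1.1, he'.2.1, hxy.symm⟩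
          rcases hf _ hmem with h1 | h1
          · exact hy.1.2 ⟨_, hmem, h1⟩
          · refine hx' (.inr ⟨_, hmem, ?_⟩)
            rw [hf'ne, h1]
            intro h2
            exact hy.2 (by rw [← h2]; rfl)
        · exact hx' (.inr ⟨e', he', hf'ne hne⟩)
    by_cases hmem : e.1 ∈ f '' crossings G i j
    · rwa [insert_eq_of_mem (.inr hmem), sdiff_singleton_eq_self fun h => h.2 hmem] at hswap
    · exact .place e.1 ⟨he.1, hmem⟩ hX hswap

/-- A sweep of the part of the graph behind a chord, from any set that contains the ends of the
chord and an end of each crossing edge. -/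
theorem Sweep.of_subset {p q : V} {Y : Set V} (hs : crossNum G p q + 3 ≤ s)
    (h : Sweep G s ({p, q} ∪ Prod.fst '' crossings G p q) (Ioo p q \ Prod.fst '' crossings G p q))
    (hp : p ∈ Y) (hq : q ∈ Y) (hcov : ∀ e ∈ crossings G p q, e.1 ∈ Y ∨ e.2 ∈ Y)
    (hY : ∀ y ∈ Y, y ∈ Ioo p q → ∃ b, (y, b) ∈ crossings G p q) : Sweep G s Y (Ioo p q \ Y) := by
  classical
  -- Preferring inner ends makes `f` pick every vertex of `Y` behind the chord, by `hY`. Thus `Y`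
  -- and the image of `f` leave the same part unswept.
  let f : V × V → V := fun e => if e.1 ∈ Y then e.1 else e.2
  have hfst {e : V × V} (he : e.1 ∈ Y) : f e = e.1 := if_pos he
  have hsnd {e : V × V} (he : e.1 ∉ Y) : f e = e.2 := if_neg he
  have hfY {e : V × V} (he : e ∈ crossings G p q) : f e ∈ Y := by
    by_cases h1 : e.1 ∈ Y
    · rwa [hfst h1]
    · rw [hsnd h1]; exact (hcov e he).resolve_left h1
  have hsweep := h.exchange hs f fun e _ => ite_eq_or_eq ..
  have hC : Ioo p q \ Y = Ioo p q \ f '' crossings G p q := by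
    ext z
    refine and_congr_right fun hz => not_congr ⟨fun hzY => ?_, ?_⟩
    · obtain ⟨b, hb⟩ := hY z hzY hz
      exact ⟨_, hb, hfst hzY⟩
    · rintro ⟨e, he, rfl⟩
      exact hfY he
  rw [hC]
  refine .forget ?_ ?_ hsweep
  · rintro x ((rfl | rfl) | ⟨e, he, rfl⟩)
    exacts [hp, hq, hfY he]
  · intro x hx hx' y hy hxy
    rw [← hC] at hy
    have hxO : x ∉ Icc p q := fun hxpq => by
      rcases hxpq.1.eq_or_lt with rfl | h1
      · exact hx' (.inl (.inl rfl))
      rcases hxpq.2.eq_or_lt with rfl | h2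
      · exact hx' (.inl (.inr rfl))
      obtain ⟨b, hb⟩ := hY x hx ⟨h1, h2⟩
      exact hx' (.inr ⟨_, hb, hfst hx⟩)
    exact hx' (.inr ⟨(y, x), ⟨hy.1, hxO, hxy.symm⟩, hsnd hy.2⟩)

/-- Split the chord by `exists_split`, occupy the third corner and an end of each edge between the
two inner intervals, then sweep behind the two new sides independently. -/
theorem sweep_chord (hG : ∀ u v, u < v → G.Adj u v → crossNum G u v ≤ k) {i j : V}
    (hlt : i < j) (hij : crossNum G i j ≤ k) :
    Sweep G (3 * k / 2 + 3) ({i, j} ∪ Prod.fst '' crossings G i j)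
      (Ioo i j \ Prod.fst '' crossings G i j) := by
  induction hn : (Ioo i j).ncard using Nat.strong_induction_on generalizing i j with
  | _ n ih =>
  rcases (Ioo i j).eq_empty_or_nonempty with hempty | hne
  · rw [hempty, empty_sdiff]
    exact .nil _
  obtain ⟨l, hl, hil, hlj⟩ := exists_split hG hij hne
  subst hn
  have h₁ := ih _ (ncard_lt_ncard ⟨Ioo_subset_Ioo_right hl.2.le,
    fun h => lt_irrefl l (h hl).2⟩) hl.1 hil rfl
  have h₂ := ih _ (ncard_lt_ncard ⟨Ioo_subset_Ioo_left hl.1.le,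
    fun h => lt_irrefl l (h hl).1⟩) hl.2 hlj rfl
  set I := Prod.fst '' crossings G i j with hI
  set L := Prod.fst '' edgesBetween G (Ioo i l) (Ioo l j) with hL
  have hLil : L ⊆ Ioo i l := by
    rintro _ ⟨e, he, rfl⟩
    exact he.1
  have hIij : I ⊆ Ioo i j := by
    rintro _ ⟨e, he, rfl⟩
    exact he.1
  set Y : Set V := ({i, j} ∪ I) ∪ ({l} ∪ L) with hY
  have hYcard : Y.ncard ≤ 3 * k / 2 + 3 := by
    have hsub : Y ⊆ ({i, j, l} ∪ L) ∪ (Prod.fst '' edgesBetween G (Ioo i l) (Icc i j)ᶜ ∪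
        Prod.fst '' edgesBetween G (Ioo l j) (Icc i j)ᶜ) := by
      rintro x (((rfl | rfl) | ⟨e, he, rfl⟩) | (rfl | hx))
      · exact .inl (.inl (.inl rfl))
      · exact .inl (.inl (.inr (.inl rfl)))
      · rcases lt_trichotomy e.1 l with h | h | h
        · exact .inr (.inl ⟨e, ⟨⟨he.1.1, h⟩, he.2⟩, rfl⟩)
        · exact .inl (.inl (.inr (.inr h)))
        · exact .inr (.inr ⟨e, ⟨⟨h, he.1.2⟩, he.2⟩, rfl⟩)
      · exact .inl (.inl (.inr (.inr rfl)))
      · exact .inl (.inr hx)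
    have e1 := (ncard_le_ncard hsub).trans (ncard_union_le _ _)
    have e2 := ncard_union_le {i, j, l} L
    have e3 := ncard_union_le (Prod.fst '' edgesBetween G (Ioo i l) (Icc i j)ᶜ)
      (Prod.fst '' edgesBetween G (Ioo l j) (Icc i j)ᶜ)
    have e4 : ({i, j, l} : Set V).ncard ≤ 3 := by
      have := ncard_insert_le i {j, l}
      have := ncard_insert_le j {l}
      rw [ncard_singleton] at this
      omega
    have e5 : L.ncard ≤ numEdges G (Ioo i l) (Ioo l j) := ncard_image_le (toFinite _)
    have e6 : (Prod.fst '' edgesBetween G (Ioo i l) (Icc i j)ᶜ).ncard ≤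
      numEdges G (Ioo i l) (Icc i j)ᶜ := ncard_image_le (toFinite _)
    have e7 : (Prod.fst '' edgesBetween G (Ioo l j) (Icc i j)ᶜ).ncard ≤
      numEdges G (Ioo l j) (Icc i j)ᶜ := ncard_image_le (toFinite _)
    have e8 : numEdges G (Ioo i l) (Ioo l j) + numEdges G (Ioo i l) (Icc i j)ᶜ ≤ crossNum G i l :=
      add_le_numEdges subset_rfl (fun x hx h => not_lt.2 h.2 hx.1) subset_rfl
        (fun x hx h => hx ⟨h.1, h.2.trans hl.2.le⟩)
        fun u v _ hv _ hv' => hv' ⟨(hl.1.trans hv.1).le, hv.2.le⟩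
    have e9 : numEdges G (Ioo l j) (Ioo i l) + numEdges G (Ioo l j) (Icc i j)ᶜ ≤ crossNum G l j :=
      add_le_numEdges subset_rfl (fun x hx h => not_lt.2 h.1 hx.2) subset_rfl
        (fun x hx h => hx ⟨hl.1.le.trans h.1, h.2⟩)
        fun u v _ hv _ hv' => hv' ⟨hv.1.le, (hv.2.trans hl.2).le⟩
    -- The three classes of edges through the triangle are each counted in two of `e8`, `e9`, `e10`,
    -- so twice their total is at most `3k`.
    have e10 : numEdges G (Ioo i l) (Icc i j)ᶜ + numEdges G (Ioo l j) (Icc i j)ᶜ ≤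
        crossNum G i j :=
      add_le_numEdges (Ioo_subset_Ioo_right hl.2.le) subset_rfl (Ioo_subset_Ioo_left hl.1.le)
        subset_rfl fun u v hu _ hu' _ => lt_asymm hu.2 hu'.1
    rw [numEdges_comm (Ioo l j) (Ioo i l)] at e9
    omega
  have hiY : i ∈ Y := .inl (.inl (.inl rfl))
  have hjY : j ∈ Y := .inl (.inl (.inr rfl))
  have hlY : l ∈ Y := .inr (.inl rfl)
  have hlsub : {l} ∪ L ⊆ Ioo i j := union_subset (singleton_subset_iff.2 hl)
    (hLil.trans (Ioo_subset_Ioo_right hl.2.le))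
  have hsplit : (Ioo i j \ I) \ (({l} ∪ L) \ I) = (Ioo i l \ Y) ∪ (Ioo l j \ Y) := by
    ext z
    constructor
    · rintro ⟨⟨hz, hzI⟩, hz'⟩
      have hzlL : z ∉ {l} ∪ L := fun h => hz' ⟨h, hzI⟩
      have hzY : z ∉ Y := by
        rintro (((rfl | rfl) | h) | h)
        exacts [lt_irrefl _ hz.1, lt_irrefl _ hz.2, hzI h, hzlL h]
      rcases lt_trichotomy z l with h | rfl | h
      · exact .inl ⟨⟨hz.1, h⟩, hzY⟩
      · exact (hzY hlY).elim
      · exact .inr ⟨⟨h, hz.2⟩, hzY⟩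
    · rintro (⟨hz, hzY⟩ | ⟨hz, hzY⟩)
      · exact ⟨⟨⟨hz.1, hz.2.trans hl.2⟩, fun h => hzY (.inl (.inr h))⟩, fun h => hzY (.inr h.1)⟩
      · exact ⟨⟨⟨hl.1.trans hz.1, hz.2⟩, fun h => hzY (.inl (.inr h))⟩, fun h => hzY (.inr h.1)⟩
  have hunion : ({i, j} ∪ I) ∪ (({l} ∪ L) \ I) = Y := by
    rw [hY, union_assoc, union_assoc, union_sdiff_self]
  refine Sweep.place_of_subset (Y := ({l} ∪ L) \ I) ?_ (sdiff_subset_sdiff_left hlsub)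
    (by rwa [hunion]) ?_
  · rw [disjoint_left]
    rintro x ((rfl | rfl) | hx) ⟨h, hxI⟩
    exacts [lt_irrefl _ h.1, lt_irrefl _ h.2, hxI hx]
  rw [hunion, hsplit]
  refine .join ?_ ?_ ?_ ?_
  · rw [disjoint_left]
    rintro x ⟨h, -⟩ ⟨h', -⟩
    exact lt_asymm h.2 h'.1
  · rintro u ⟨hu, huY⟩ v ⟨hv, -⟩ huv
    exact huY (.inr (.inr ⟨(u, v), ⟨hu, hv, huv⟩, rfl⟩))
  · refine h₁.of_subset (by omega) hiY hlY ?_ ?_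
    · rintro ⟨u, v⟩ ⟨hu, hv, huv⟩
      by_cases hvO : v ∈ Icc i j
      · have hlv : l < v := by
          by_contra! h
          exact hv ⟨hvO.1, h⟩
        rcases hvO.2.eq_or_lt with rfl | h
        · exact .inr hjY
        · exact .inl (.inr (.inr ⟨(u, v), ⟨hu, ⟨hlv, h⟩, huv⟩, rfl⟩))
      · exact .inl (.inl (.inr ⟨(u, v), ⟨⟨hu.1, hu.2.trans hl.2⟩, hvO, huv⟩, rfl⟩))
    · rintro y (((rfl | rfl) | ⟨⟨u, v⟩, he, rfl⟩) | (rfl | ⟨⟨u, v⟩, he, rfl⟩)) hy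
      · exact (lt_irrefl _ hy.1).elim
      · exact (lt_asymm hl.2 hy.2).elim
      · exact ⟨v, hy, fun h => he.2.1 ⟨h.1, h.2.trans hl.2.le⟩, he.2.2⟩
      · exact (lt_irrefl _ hy.2).elim
      · exact ⟨v, hy, fun h => not_lt.2 h.2 he.2.1.1, he.2.2⟩
  · refine h₂.of_subset (by omega) hlY hjY ?_ ?_
    · rintro ⟨u, v⟩ ⟨hu, hv, huv⟩
      by_cases hvO : v ∈ Icc i j
      · have hlv : v < l := by
          by_contra! h
          exact hv ⟨h, hvO.2⟩
        rcases hvO.1.eq_or_lt with rfl | h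
        · exact .inr hiY
        · exact .inr (.inr (.inr ⟨(v, u), ⟨⟨h, hlv⟩, hu, huv.symm⟩, rfl⟩))
      · exact .inl (.inl (.inr ⟨(u, v), ⟨⟨hl.1.trans hu.1, hu.2⟩, hvO, huv⟩, rfl⟩))
    · rintro y (((rfl | rfl) | ⟨⟨u, v⟩, he, rfl⟩) | (rfl | hyL)) hy
      · exact (lt_asymm hl.1 hy.1).elim
      · exact (lt_irrefl _ hy.2).elim
      · exact ⟨v, hy, fun h => he.2.1 ⟨hl.1.le.trans h.1, h.2⟩, he.2.2⟩
      · exact (lt_irrefl _ hy.1).elim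
      · exact (lt_asymm hy.1 (hLil hyL).2).elim

theorem sweep_univ (hG : ∀ u v, u < v → G.Adj u v → crossNum G u v ≤ k) :
    Sweep G (3 * k / 2 + 3) ∅ univ := by
  rcases isEmpty_or_nonempty V with _ | _
  · rw [univ_eq_empty_iff.2 ‹_›]
    exact .nil _
  obtain ⟨i, -, hi⟩ := exists_min_image (univ : Set V) id (toFinite _) univ_nonempty
  obtain ⟨j, -, hj⟩ := exists_max_image (univ : Set V) id (toFinite _) univ_nonempty
  refine .place i (mem_univ _) (by rw [ncard_empty]; omega) ?_
  rw [insert_empty_eq]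
  rcases (show i ≤ j from hi j (mem_univ _)).eq_or_lt with rfl | hlt
  · have : (univ \ {i} : Set V) = ∅ := by
      rw [eq_empty_iff_forall_notMem]
      rintro x ⟨-, hx⟩
      exact hx (le_antisymm (hj x (mem_univ _)) (hi x (mem_univ _)))
    rw [this]
    exact .nil _
  -- All vertices lie between the first and the last one, so this chord has no crossings and
  -- everything else is behind it.
  have hO : (Icc i j)ᶜ = (∅ : Set V) := by
    rw [compl_empty_iff, eq_univ_iff_forall]
    exact fun x => ⟨hi x (mem_univ _), hj x (mem_univ _)⟩
  have hcr : crossings G i j = ∅ := by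
    rw [crossings, hO, eq_empty_iff_forall_notMem]
    exact fun e he => he.2.1
  have h := sweep_chord hG hlt (show crossNum G i j ≤ k by
    rw [crossNum, numEdges, ← crossings, hcr, ncard_empty]; exact Nat.zero_le _)
  rw [hcr, image_empty, union_empty, sdiff_empty] at h
  refine .place j ⟨mem_univ _, fun h => hlt.ne' h⟩ (by rw [ncard_singleton]; omega) ?_
  have hC : (univ \ {i}) \ {j} = Ioo i j := by
    ext x
    constructor
    · rintro ⟨⟨-, h1⟩, h2⟩
      exact ⟨lt_of_le_of_ne (hi x (mem_univ _)) (Ne.symm h1), lt_of_le_of_ne (hj x (mem_univ _)) h2⟩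
    · exact fun hx => ⟨⟨mem_univ _, hx.1.ne'⟩, hx.2.ne⟩
  rwa [hC, pair_comm]

end Sweep
/-! ### Tree decompositions from sweeps -/

section AttachLeaf

variable {ι : Type*}

/-- The graph that is obtained by attaching a new vertex to the vertex `i₀`. -/
def attachLeaf (T : SimpleGraph ι) (i₀ : ι) : SimpleGraph (Option ι) where
  Adj a b := (∃ x y, a = some x ∧ b = some y ∧ T.Adj x y) ∨ (a = none ∧ b = some i₀) ∨
    (a = some i₀ ∧ b = none)
  symm := ⟨by
    rintro a b (⟨x, y, rfl, rfl, h⟩ | ⟨rfl, rfl⟩ | ⟨rfl, rfl⟩)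
    exacts [.inl ⟨y, x, rfl, rfl, h.symm⟩, .inr (.inr ⟨rfl, rfl⟩), .inr (.inl ⟨rfl, rfl⟩)]⟩
  loopless := ⟨by
    rintro a (⟨x, y, rfl, h, hxy⟩ | ⟨rfl, h⟩ | ⟨rfl, h⟩)
    · exact hxy.ne (Option.some_injective _ h)
    · cases h
    · cases h⟩

variable {T : SimpleGraph ι} {i₀ : ι}

theorem attachLeaf_adj_some {x y : ι} (h : T.Adj x y) :
    (attachLeaf T i₀).Adj (some x) (some y) := .inl ⟨x, y, rfl, rfl, h⟩

theorem attachLeaf_adj_none : (attachLeaf T i₀).Adj (some i₀) none := .inr (.inr ⟨rfl, rfl⟩)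

theorem edgeSet_attachLeaf :
    (attachLeaf T i₀).edgeSet = insert s(some i₀, none) (Sym2.map some '' T.edgeSet) := by
  ext e
  induction e with | _ a b =>
  simp only [SimpleGraph.mem_edgeSet, mem_insert_iff, mem_image]
  constructor
  · rintro (⟨x, y, rfl, rfl, h⟩ | ⟨rfl, rfl⟩ | ⟨rfl, rfl⟩)
    · exact .inr ⟨s(x, y), h, rfl⟩
    · exact .inl Sym2.eq_swap
    · exact .inl rfl
  · rintro (h | ⟨e, he, heq⟩)
    · rw [← SimpleGraph.mem_edgeSet, h]
      exact attachLeaf_adj_none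
    · rw [← SimpleGraph.mem_edgeSet, ← heq]
      induction e with | _ x y =>
      exact attachLeaf_adj_some he

theorem isTree_attachLeaf [Finite ι] (hT : T.IsTree) : (attachLeaf T i₀).IsTree := by
  rw [SimpleGraph.isTree_iff_connected_and_card] at hT ⊢
  obtain ⟨hconn, hcard⟩ := hT
  constructor
  · rw [SimpleGraph.connected_iff_exists_forall_reachable]
    refine ⟨some i₀, fun a => ?_⟩
    cases a with
    | none => exact attachLeaf_adj_none.reachable
    | some x =>
      exact (hconn i₀ x).map (⟨some, attachLeaf_adj_some⟩ : T →g attachLeaf T i₀)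
  · have hnot : s(some i₀, none) ∉ Sym2.map some '' T.edgeSet := by
      rintro ⟨e, -, he⟩
      have : none ∈ Sym2.map some e := by rw [he]; exact Sym2.mem_mk_right _ _
      rw [Sym2.mem_map] at this
      obtain ⟨x, -, hx⟩ := this
      cases hx
    rw [Nat.card_coe_set_eq] at hcard ⊢
    rw [edgeSet_attachLeaf, ncard_insert_of_notMem hnot,
      ncard_image_of_injective _ (Sym2.map.injective (Option.some_injective _)), hcard,
      Finite.card_option]

theorem connected_induce_attachLeaf {S : Set ι} {S' : Set (Option ι)}
    (hS : (T.induce S).Connected) (hsome : ∀ x, some x ∈ S' ↔ x ∈ S)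
    (hnone : none ∈ S' → i₀ ∈ S) : ((attachLeaf T i₀).induce S').Connected := by
  let f : T.induce S →g (attachLeaf T i₀).induce S' :=
    ⟨fun x => ⟨some x.1, (hsome _).2 x.2⟩, fun h => attachLeaf_adj_some h⟩
  obtain ⟨a⟩ := hS.nonempty
  rw [SimpleGraph.connected_iff_exists_forall_reachable]
  refine ⟨f a, ?_⟩
  rintro ⟨b | b, hb⟩
  · refine ((hS a ⟨i₀, hnone hb⟩).map f).trans (SimpleGraph.Adj.reachable ?_)
    exact attachLeaf_adj_none
  · exact (hS a ⟨b, (hsome _).1 hb⟩).map f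

end AttachLeaf

section PartialDecomposition

variable {V : Type*}

/-- A tree decomposition of the subgraph of `G` that is induced by `W`, with bags of size at
most `s`. -/
structure PartialDecomposition (G : SimpleGraph V) (s : ℕ) (W : Set V) where
  ι : Type
  finiteNodes : Finite ι
  tree : SimpleGraph ι
  isTree : tree.IsTree
  bag : ι → Set V
  bag_subset : ∀ i, bag i ⊆ W
  ncard_bag_le : ∀ i, (bag i).ncard ≤ s
  edge_mem_bag : ∀ u ∈ W, ∀ v ∈ W, G.Adj u v → ∃ i, u ∈ bag i ∧ v ∈ bag i
  connected_nodes : ∀ v ∈ W, (tree.induce {i | v ∈ bag i}).Connected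

variable {G : SimpleGraph V} {s : ℕ} {W : Set V}

/-- The tree decomposition of the empty graph with one empty bag. -/
def PartialDecomposition.empty : PartialDecomposition G s ∅ where
  ι := Unit
  finiteNodes := inferInstance
  tree := ⊥
  isTree := .of_subsingleton
  bag _ := ∅
  bag_subset _ := subset_rfl
  ncard_bag_le _ := by simp
  edge_mem_bag u hu := hu.elim
  connected_nodes v hv := hv.elim

/-- Attaching a new leaf whose bag has one new vertex. -/
def PartialDecomposition.insertLeaf (D : PartialDecomposition G s W) (i₀ : D.ι) {X : Set V}
    (hX : X ⊆ D.bag i₀) {w : V} (hw : w ∉ W) (hs : X.ncard + 1 ≤ s)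
    (hN : ∀ v ∈ W, G.Adj w v → v ∈ X) : PartialDecomposition G s (insert w W) where
  ι := Option D.ι
  finiteNodes := have := D.finiteNodes; inferInstance
  tree := attachLeaf D.tree i₀
  isTree := have := D.finiteNodes; isTree_attachLeaf D.isTree
  bag i := i.elim (insert w X) D.bag
  bag_subset i := by
    cases i with
    | none => exact insert_subset_insert (hX.trans (D.bag_subset i₀))
    | some i => exact (D.bag_subset i).trans (subset_insert _ _)
  ncard_bag_le i := by
    cases i with
    | none => exact (ncard_insert_le _ _).trans hs
    | some i => exact D.ncard_bag_le i
  edge_mem_bag := by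
    rintro u (rfl | hu) v (rfl | hv) huv
    · exact (huv.ne rfl).elim
    · exact ⟨none, .inl rfl, .inr (hN v hv huv)⟩
    · exact ⟨none, .inr (hN u hu huv.symm), .inl rfl⟩
    · obtain ⟨i, hi⟩ := D.edge_mem_bag u hu v hv huv
      exact ⟨some i, hi⟩
  connected_nodes := by
    have hne {i : D.ι} {v : V} (h : v ∈ D.bag i) : v ≠ w := by
      rintro rfl
      exact hw (D.bag_subset i h)
    rintro v (rfl | hv)
    · have hsub : Subsingleton {i : Option D.ι | v ∈ i.elim (insert v X) D.bag} := by
        refine ⟨?_⟩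
        rintro ⟨_ | a, ha⟩ ⟨_ | b, hb⟩
        · rfl
        · exact (hne hb rfl).elim
        · exact (hne ha rfl).elim
        · exact (hne ha rfl).elim
      have : Nonempty {i : Option D.ι | v ∈ i.elim (insert v X) D.bag} := ⟨none, .inl rfl⟩
      exact (SimpleGraph.IsTree.of_subsingleton).connected
    · refine connected_induce_attachLeaf (D.connected_nodes v hv) (fun x => Iff.rfl) ?_
      rintro (rfl | h)
      · exact (hw hv).elim
      · exact hX h

/-- Each placement attaches a leaf with bag `insert w X` to a node whose bag contains `X`. That old
bags survive inside new ones is needed at a `join`: the second part must be attached to a bag that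
still contains `X`. -/
theorem Sweep.exists_partialDecomposition {X C : Set V} (h : Sweep G s X C)
    (D : PartialDecomposition G s W) (i₀ : D.ι) (hX : X ⊆ D.bag i₀) (hW : Disjoint W C)
    (hN : ∀ u ∈ C, ∀ v, G.Adj u v → v ∈ X ∪ C) :
    ∃ D' : PartialDecomposition G s (W ∪ C), ∀ i, ∃ i', D.bag i ⊆ D'.bag i' := by
  induction h generalizing W with
  | nil X =>
    rw [union_empty]
    exact ⟨D, fun i => ⟨i, subset_rfl⟩⟩
  | @join X C₁ C₂ hC hadj h₁ h₂ ih₁ ih₂ =>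
    obtain ⟨D₁, hD₁⟩ := ih₁ D i₀ hX (hW.mono_right subset_union_left) fun u hu v huv =>
      (hN u (.inl hu) v huv).imp_right fun h => h.resolve_right fun h' => hadj u hu v h' huv
    obtain ⟨i₁, hi₁⟩ := hD₁ i₀
    have hD₂ := ih₂ D₁ i₁ (hX.trans hi₁)
      (disjoint_union_left.2 ⟨hW.mono_right subset_union_right, hC⟩) fun u hu v huv =>
        (hN u (.inr hu) v huv).imp_right fun h => h.resolve_left fun h' => hadj v h' u hu huv.symm
    rw [union_assoc] at hD₂
    obtain ⟨D₂, hD₂⟩ := hD₂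
    refine ⟨D₂, fun i => ?_⟩
    obtain ⟨j, hj⟩ := hD₁ i
    obtain ⟨j', hj'⟩ := hD₂ j
    exact ⟨j', hj.trans hj'⟩
  | @forget X X' C hX' hadj h ih =>
    refine ih D i₀ (hX'.trans hX) hW fun u hu v huv => (hN u hu v huv).imp_left fun hv => ?_
    by_contra hv'
    exact hadj v hv hv' u hu huv.symm
  | @place X C w hw hs h ih =>
    have hwW : w ∉ W := fun h => disjoint_left.1 hW h hw
    let D₁ := D.insertLeaf i₀ hX hwW hs fun v hv hwv =>
      (hN w hw v hwv).resolve_right (disjoint_left.1 hW hv)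
    have hD₁ := ih D₁ none subset_rfl (by
      rw [disjoint_left]
      rintro x (rfl | hx) ⟨hxC, hxw⟩
      · exact hxw rfl
      · exact disjoint_left.1 hW hx hxC) fun u hu v huv => by
        rcases hN u hu.1 v huv with hv | hv
        · exact .inl (.inr hv)
        · by_cases hvw : v = w
          · exact .inl (.inl hvw)
          · exact .inr ⟨hv, hvw⟩
    have hunion : insert w W ∪ C \ {w} = W ∪ C := by
      rw [insert_union, ← union_insert, insert_sdiff_singleton, insert_eq_of_mem hw]
    rw [hunion] at hD₁
    obtain ⟨D', hD'⟩ := hD₁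
    exact ⟨D', fun i => hD' (some i)⟩

theorem treewidth_le_of_sweep [Finite V] (h : Sweep G s ∅ univ) : treewidth G ≤ s - 1 := by
  obtain ⟨D, -⟩ := h.exists_partialDecomposition .empty () subset_rfl
    (disjoint_left.2 fun x hx => hx.elim) fun _ _ v _ => .inr (mem_univ v)
  rw [empty_union] at D
  have := Fintype.ofFinite V
  have hfin := D.finiteNodes
  classical
  let D' : TreeDecomposition G :=
    { ι := D.ι
      fintypeNodes := Fintype.ofFinite _
      tree := D.tree
      isTree := D.isTree
      bag := fun i => (D.bag i).toFinset
      edge_mem_bag := fun u v huv => by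
        simpa using D.edge_mem_bag u (mem_univ _) v (mem_univ _) huv
      connected_nodes := fun v => by
        have hset : {i | v ∈ (D.bag i).toFinset} = {i | v ∈ D.bag i} := by ext; simp
        rw [hset]
        exact D.connected_nodes v (mem_univ _) }
  have hwidth : D'.width ≤ s - 1 := Nat.sub_le_sub_right (Finset.sup_le fun i _ => ?_) 1
  · have hmem : D'.width ∈ {w | ∃ D : TreeDecomposition G, D.width = w} := ⟨D', rfl⟩
    exact (Nat.sInf_le hmem).trans hwidth
  change (D.bag i).toFinset.card ≤ s
  rw [← ncard_eq_toFinset_card']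
  exact D.ncard_bag_le i

end PartialDecomposition
/-! ### Catching a robber along a sweep -/

section Cops

variable {V : Type*} (G : SimpleGraph V)

/-- Two vertices are near if they are equal or adjacent. -/
def Near (x y : V) : Prop := y = x ∨ G.Adj x y

/-- A cop at `h x` can answer each move of a robber from `x` to `y` within `S` by going to
`h' y`. -/
def Follows (S : Set V) (h h' : V → V) : Prop :=
  ∀ x ∈ S, ∀ y ∈ S, Near G x y → Near G (h x) (h' y)

/-- A cop who follows a robber in `R` by `h` can pass over to `h'` in finitely many moves, while
guarding the vertices in `N`. -/
def Deforms (R N : Set V) : (V → V) → (V → V) → Prop :=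
  Relation.ReflTransGen fun h h' => (∀ u ∈ N, h' u = u) ∧ Follows G (R ∪ N) h h'

/-- A cop who follows a robber in `R` by `h` guards the vertices in `N`, and can retreat to each
of them while guarding it. -/
structure Guards (R N : Set V) (h : V → V) : Prop where
  fix : ∀ u ∈ N, h u = u
  follows : Follows G (R ∪ N) h h
  deforms : ∀ u ∈ N, Deforms G R {u} h fun _ => u

/-- Cops at the positions `p` can force the capture of a robber at `r` who is next to move. -/
def Holds {c : ℕ} (p : Fin c → V) (r : V) : Prop := ∀ r', Near G r r' → CopsCatch G p r'

variable {G}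

theorem Near.rfl {x : V} : Near G x x := .inl (Eq.refl x)

theorem Near.symm {x y : V} (h : Near G x y) : Near G y x :=
  h.imp Eq.symm SimpleGraph.Adj.symm

theorem Follows.mono {S S' : Set V} {h h' : V → V} (hS : S' ⊆ S) (H : Follows G S h h') :
    Follows G S' h h' := fun x hx y hy => H x (hS hx) y (hS hy)

theorem Deforms.mono {R R' N : Set V} {h h' : V → V} (hR : R' ⊆ R) (H : Deforms G R N h h') :
    Deforms G R' N h h' := by
  induction H with
  | refl => exact .refl
  | tail _ hs ih => exact ih.tail ⟨hs.1, hs.2.mono (union_subset_union_left _ hR)⟩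

theorem deforms_of_forall {R N : Set V} (f : ℕ → V → V) (n : ℕ) (hfix : ∀ t, ∀ u ∈ N, f t u = u)
    (hf : ∀ t, Follows G (R ∪ N) (f t) (f (t + 1))) : Deforms G R N (f 0) (f n) := by
  induction n with
  | zero => exact .refl
  | succ n ih => exact ih.tail ⟨hfix _, hf n⟩

theorem Guards.mono {R R' N N' : Set V} {h : V → V} (H : Guards G R N h) (hR : R' ⊆ R)
    (hN : N' ⊆ N) : Guards G R' N' h :=
  ⟨fun u hu => H.fix u (hN hu), H.follows.mono (union_subset_union hR hN),
    fun u hu => (H.deforms u (hN hu)).mono hR⟩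

theorem guards_const (R : Set V) (w : V) : Guards G R {w} fun _ => w :=
  ⟨fun _ hu => hu.symm, fun _ _ _ _ _ => .rfl, fun u hu => by rw [hu]; exact .refl⟩

theorem CopsCatch.of_near {c : ℕ} {p : Fin c → V} {r : V} (i : Fin c) (h : Near G (p i) r) :
    CopsCatch G p r := by
  classical
  refine .capture p (Function.update p i r) r (fun j => ?_) i (Function.update_self ..)
  rcases eq_or_ne j i with rfl | hne
  · rw [Function.update_self]; exact h
  · exact .inl (Function.update_of_ne hne ..)

/-- Cop `i` runs through the chain from `g` to `g'` while the others keep following. A robber who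
leaves `R` must enter a guarded vertex, where its guard captures at once. -/
theorem holds_of_deforms {c : ℕ} {R N : Set V} {h : Fin c → V → V} {M : Fin c → Set V} {i : Fin c}
    {g g' : V → V} (H : Deforms G R N g g')
    (hM : ∀ j, j ≠ i → (∀ u ∈ M j, h j u = u) ∧ Follows G (R ∪ M j) (h j) (h j))
    (hR : ∀ x ∈ R, ∀ y, G.Adj x y → y ∈ R ∨ y ∈ N ∨ ∃ j, j ≠ i ∧ y ∈ M j)
    (hg' : ∀ r ∈ R, Holds G (fun j => Function.update h i g' j r) r) :
    ∀ r ∈ R, Holds G (fun j => Function.update h i g j r) r := by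
  induction H using Relation.ReflTransGen.head_induction_on with
  | refl => exact hg'
  | @head g g₁ hstep _ ih =>
    intro r hr r' hr'
    have hcase : r' ∈ R ∨ r' ∈ N ∨ ∃ j, j ≠ i ∧ r' ∈ M j := by
      rcases hr' with rfl | hadj
      · exact .inl hr
      · exact hR r hr r' hadj
    rcases hcase with hR' | hN' | ⟨j, hj, hjM⟩
    · refine .step _ (fun j => Function.update h i g₁ j r') r' (fun j => ?_) fun r'' hr'' =>
        ih r' hR' r'' hr''
      rcases eq_or_ne j i with rfl | hne
      · simp only [Function.update_self]
        exact hstep.2 r (.inl hr) r' (.inl hR') hr'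
      · simp only [Function.update_of_ne hne]
        exact (hM j hne).2 r (.inl hr) r' (.inl hR') hr'
    · refine .of_near i ?_
      have := hstep.2 r (.inl hr) r' (.inr hN') hr'
      rw [hstep.1 r' hN'] at this
      simpa only [Function.update_self] using this
    · refine .of_near j ?_
      have := (hM j hj).2 r (.inl hr) r' (.inr hjM) hr'
      rw [(hM j hj).1 r' hjM] at this
      simpa only [Function.update_of_ne hj] using this

theorem near_getVert {H : SimpleGraph V} (hH : H ≤ G) {u v : V} (p : H.Walk u v) {m n : ℕ}
    (hmn : m ≤ n + 1) (hnm : n ≤ m + 1) : Near G (p.getVert m) (p.getVert n) := by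
  have succ (m : ℕ) : Near G (p.getVert m) (p.getVert (m + 1)) := by
    rcases lt_or_ge m p.length with h | h
    · exact .inr (hH (p.adj_getVert_succ h))
    · refine .inl ?_
      rw [p.getVert_of_length_le h, p.getVert_of_length_le (h.trans (Nat.le_succ _))]
  rcases lt_trichotomy m n with h | rfl | h
  · obtain rfl : n = m + 1 := by omega
    exact succ m
  · exact .rfl
  · obtain rfl : m = n + 1 := by omega
    exact (succ n).symm

variable (G) in
/-- The graph of the edges of `G` with both ends in `S`. -/
def restrict (S : Set V) : SimpleGraph V where
  Adj x y := G.Adj x y ∧ x ∈ S ∧ y ∈ S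
  symm := ⟨fun _ _ h => ⟨h.1.symm, h.2.2, h.2.1⟩⟩
  loopless := ⟨fun _ h => h.1.ne rfl⟩

theorem restrict_le (S : Set V) : restrict G S ≤ G := fun _ _ h => h.1

theorem restrict_mono {S S' : Set V} (h : S ⊆ S') : restrict G S ≤ restrict G S' :=
  fun _ _ h' => ⟨h'.1, h h'.2.1, h h'.2.2⟩

theorem reachable_restrict_component {R : Set V} {r x : V} (h : (restrict G R).Reachable r x) :
    (restrict G {y | (restrict G R).Reachable r y}).Reachable r x := by
  have h' := h
  rw [SimpleGraph.reachable_iff_reflTransGen] at h'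
  induction h' with
  | refl => exact .refl _
  | @tail b c hb hadj ih =>
    have hb' : (restrict G R).Reachable r b := (SimpleGraph.reachable_iff_reflTransGen _ _).2 hb
    have hbc : (restrict G {y | (restrict G R).Reachable r y}).Adj b c := ⟨hadj.1, hb', h⟩
    exact (ih hb').trans hbc.reachable

/-- A cop on `u` can start to guard a shortest path from `u` to `w`. -/
theorem exists_guards_pair {R : Set V} {u w : V} (hw : w ∈ R)
    (hreach : ∀ x ∈ R, (restrict G (insert u R)).Reachable u x) :
    ∃ g, Guards G R {u, w} g ∧ Deforms G R {u} (fun _ => u) g := by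
  set H := restrict G (insert u R)
  have hHG : H ≤ G := restrict_le _
  have hreach' : ∀ x ∈ insert u R, H.Reachable u x := by
    rintro x (rfl | hx)
    exacts [.refl _, hreach x hx]
  -- Distance from `u` changes by at most one per robber move, so sending `x` to the vertex of a
  -- shortest path at index `H.dist u x` gives a shadow that a cop can follow.
  have hdist {x y : V} (hx : x ∈ insert u R) (hy : y ∈ insert u R) (h : Near G x y) :
      H.dist u y ≤ H.dist u x + 1 := by
    rcases h with rfl | h
    · omega
    obtain ⟨q, hq⟩ := (hreach' x hx).exists_walk_length_eq_dist
    have := SimpleGraph.dist_le (q.concat (show H.Adj x y from ⟨h, hx, hy⟩))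
    rwa [SimpleGraph.Walk.length_concat, hq] at this
  obtain ⟨p, hp⟩ := (hreach w hw).exists_walk_length_eq_dist
  have hfollows {f f' : ℕ → ℕ} (h1 : ∀ m n, m ≤ n + 1 → n ≤ m + 1 → f m ≤ f' n + 1)
      (h2 : ∀ m n, m ≤ n + 1 → n ≤ m + 1 → f' n ≤ f m + 1) :
      Follows G (insert u R) (fun x => p.getVert (f (H.dist u x)))
        (fun x => p.getVert (f' (H.dist u x))) := fun x hx y hy hxy =>
    near_getVert hHG p (h1 _ _ (hdist hy hx hxy.symm) (hdist hx hy hxy))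
      (h2 _ _ (hdist hy hx hxy.symm) (hdist hx hy hxy))
  have hsubu : R ∪ {u} ⊆ insert u R := by rw [union_singleton]
  have hsubw : R ∪ {w} ⊆ insert u R := by
    rw [union_singleton, insert_eq_of_mem hw]
    exact subset_insert _ _
  have hsub : R ∪ {u, w} ⊆ insert u R := by
    rintro x (hx | rfl | rfl)
    exacts [.inr hx, .inl rfl, .inr hw]
  -- Beyond its length, `getVert` stays at the last vertex, so capping the index there changes
  -- nothing. The retreats and the start below cap the index by a moving bound, or raise it to one,
  -- which shifts by one per round.
  have hmin : (fun x => p.getVert (min (H.dist u x) p.length)) =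
      fun x => p.getVert (H.dist u x) := by
    funext x
    rcases le_total (H.dist u x) p.length with h | h
    · rw [min_eq_left h]
    · rw [min_eq_right h, p.getVert_of_length_le h, p.getVert_length]
  refine ⟨fun x => p.getVert (H.dist u x), ⟨?_, ?_, ?_⟩, ?_⟩
  · rintro x (rfl | rfl)
    · simp
    · rw [← hp, p.getVert_length]
  · exact (hfollows (f := id) (f' := id) (fun m n h _ => h) fun m n _ h => h).mono hsub
  · rintro x (rfl | rfl)
    · have := deforms_of_forall (G := G) (R := R) (N := {x})
        (fun t y => p.getVert (min (H.dist x y) (p.length - t))) p.length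
        (fun t y hy => by rw [mem_singleton_iff.1 hy]; simp)
        fun t => (hfollows (f := fun m => min m (p.length - t))
          (f' := fun m => min m (p.length - (t + 1))) (fun m n h h' => by omega)
          fun m n h h' => by omega).mono hsubu
      simpa only [Nat.sub_zero, Nat.sub_self, Nat.min_zero, p.getVert_zero, hmin] using this
    · have := deforms_of_forall (G := G) (R := R) (N := {x})
        (fun t y => p.getVert (max (H.dist u y) t)) p.length
        (fun t y hy => by
          rw [mem_singleton_iff.1 hy]
          exact p.getVert_of_length_le (hp.trans_le (le_max_left _ _)))
        fun t => (hfollows (f := fun m => max m t)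
          (f' := fun m => max m (t + 1)) (fun m n h h' => by omega)
          fun m n h h' => by omega).mono hsubw
      have hmax : (fun y => p.getVert (max (H.dist u y) p.length)) = fun _ => x := by
        funext y
        exact p.getVert_of_length_le (le_max_right _ _)
      simpa only [Nat.max_zero, hmax] using this
  · have := deforms_of_forall (G := G) (R := R) (N := {u})
      (fun t y => p.getVert (min (H.dist u y) t)) p.length
      (fun t y hy => by rw [mem_singleton_iff.1 hy]; simp)
      fun t => (hfollows (f := fun m => min m t)
        (f' := fun m => min m (t + 1)) (fun m n h h' => by omega)
        fun m n h h' => by omega).mono hsubu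
    simpa only [Nat.min_zero, p.getVert_zero, hmin] using this

theorem deforms_const (hG : G.Connected) (R : Set V) (v w : V) :
    Deforms G R ∅ (fun _ => v) fun _ => w := by
  obtain ⟨p⟩ := hG v w
  have := deforms_of_forall (G := G) (R := R) (N := ∅) (fun t _ => p.getVert t) p.length
    (fun _ _ h => h.elim) fun t x _ y _ _ => near_getVert le_rfl p (by omega) (by omega)
  simpa only [p.getVert_zero, p.getVert_length] using this

/-- Induction along the sweep, keeping a robber territory `R` inside `C` whose outer neighbours lie
in `X₀ ⊆ X`, with each cop guarding at most two vertices of `X₀`. Allowing `R` and `X₀` to be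
smaller than `C` and `X` lets both shrink to what the robber can reach. -/
theorem Sweep.holds [Finite V] {s c : ℕ} (hG : G.Connected) (hs : s ≤ c * 2) {X C : Set V}
    (H : Sweep G s X C) {R X₀ : Set V} (hRC : R ⊆ C) (hX₀ : X₀ ⊆ X) (hdisj : Disjoint X₀ R)
    (hR : ∀ x ∈ R, ∀ y, G.Adj x y → y ∈ R ∨ y ∈ X₀) (a : V → Fin c) (h : Fin c → V → V)
    (ha : ∀ i, {x ∈ X₀ | a x = i}.ncard ≤ 2) (hh : ∀ i, Guards G R {x ∈ X₀ | a x = i} (h i))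
    {r : V} (hr : r ∈ R) : Holds G (fun i => h i r) r := by
  induction H generalizing R X₀ a h r with
  | nil => exact (hRC hr).elim
  | @join X C₁ C₂ hC hadj h₁ h₂ ih₁ ih₂ =>
    rcases hRC hr with hr' | hr'
    · refine ih₁ (R := R ∩ C₁) inter_subset_right hX₀ (hdisj.mono_right inter_subset_left) ?_ a h
        ha (fun i => (hh i).mono inter_subset_left subset_rfl) ⟨hr, hr'⟩
      rintro x ⟨hx, hx'⟩ y hxy
      refine (hR x hx y hxy).imp_left fun hy => ⟨hy, ?_⟩
      exact (hRC hy).resolve_right fun hy' => hadj x hx' y hy' hxy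
    · refine ih₂ (R := R ∩ C₂) inter_subset_right hX₀ (hdisj.mono_right inter_subset_left) ?_ a h
        ha (fun i => (hh i).mono inter_subset_left subset_rfl) ⟨hr, hr'⟩
      rintro x ⟨hx, hx'⟩ y hxy
      refine (hR x hx y hxy).imp_left fun hy => ⟨hy, ?_⟩
      exact (hRC hy).resolve_left fun hy' => hadj y hy' x hx' hxy.symm
  | @forget X X' C hX' hadj _ ih =>
    have hsub (i : Fin c) : {x ∈ X₀ ∩ X' | a x = i} ⊆ {x ∈ X₀ | a x = i} :=
      fun x hx => ⟨hx.1.1, hx.2⟩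
    refine ih (X₀ := X₀ ∩ X') hRC inter_subset_right (hdisj.mono_left inter_subset_left) ?_ a h
      (fun i => (ncard_le_ncard (hsub i)).trans (ha i))
      (fun i => (hh i).mono subset_rfl (hsub i)) hr
    intro x hx y hxy
    refine (hR x hx y hxy).imp_right fun hy => ⟨hy, ?_⟩
    by_contra hy'
    exact hadj y (hX₀ hy) hy' x (hRC hx) hxy.symm
  | @place X C w hw hXs _ ih =>
    -- restrict the territory to the component of the robber
    set R₁ : Set V := {x | (restrict G R).Reachable r x} with hR₁
    have hR₁R : R₁ ⊆ R := by
      rintro x ⟨p⟩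
      induction p using SimpleGraph.Walk.concatRec with
      | Hnil => exact hr
      | Hconcat p hadj _ => exact hadj.2.2
    set X₁ : Set V := {x ∈ X₀ | ∃ y ∈ R₁, G.Adj y x} with hX₁
    have hX₁X₀ : X₁ ⊆ X₀ := fun x hx => hx.1
    have hclosed : ∀ x ∈ R₁, ∀ y, G.Adj x y → y ∈ R₁ ∨ y ∈ X₁ := fun x hx y hxy => by
      rcases hR x (hR₁R hx) y hxy with hy | hy
      · exact .inl (hx.trans (SimpleGraph.Adj.reachable ⟨hxy, hR₁R hx, hy⟩))
      · exact .inr ⟨hy, x, hx, hxy⟩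
    have hdisj₁ : Disjoint X₁ R₁ := hdisj.mono hX₁X₀ hR₁R
    have hsub (i : Fin c) : {x ∈ X₁ | a x = i} ⊆ {x ∈ X₀ | a x = i} :=
      fun x hx => ⟨hx.1.1, hx.2⟩
    have ha₁ (i : Fin c) : {x ∈ X₁ | a x = i}.ncard ≤ 2 := (ncard_le_ncard (hsub i)).trans (ha i)
    have hh₁ (i : Fin c) : Guards G R₁ {x ∈ X₁ | a x = i} (h i) := (hh i).mono hR₁R (hsub i)
    have hr₁ : r ∈ R₁ := .refl _
    -- If the robber cannot reach `w`, no cop needs to guard it.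
    by_cases hwR₁ : w ∉ R₁
    · exact ih (fun x hx => ⟨hRC (hR₁R hx), fun h => hwR₁ (h ▸ hx)⟩)
        ((hX₁X₀.trans hX₀).trans (subset_insert _ _)) hdisj₁ hclosed a h ha₁ hh₁ hr₁
    rw [not_not] at hwR₁
    -- a cop who guards at most one vertex
    obtain ⟨i, hi⟩ : ∃ i, {x ∈ X₁ | a x = i}.ncard < 2 := by
      classical
      have := Fintype.ofFinite V
      have hcard : X₁.toFinset.card < (Finset.univ : Finset (Fin c)).card * 2 := by
        have := ncard_le_ncard (hX₁X₀.trans hX₀)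
        rw [← ncard_eq_toFinset_card', Finset.card_univ, Fintype.card_fin]
        omega
      obtain ⟨i, -, hi⟩ := Finset.exists_card_fiber_lt_of_card_lt_mul (f := a) hcard
      refine ⟨i, lt_of_eq_of_lt ?_ hi⟩
      rw [← ncard_coe_finset]
      congr 1
      ext x
      simp
    obtain ⟨g, g', hgr, hgg', hg'⟩ : ∃ g g' : V → V, g r = h i r ∧
        Deforms G R₁ {x ∈ X₁ | a x = i} g g' ∧ Guards G R₁ (insert w {x ∈ X₁ | a x = i}) g' := by
      rcases Nat.lt_succ_iff.1 hi |>.lt_or_eq with h0 | h1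
      · rw [Nat.lt_one_iff, ncard_eq_zero] at h0
        rw [h0, insert_empty_eq]
        -- A cop with nothing to guard forgets the old strategy, keeping only the present position,
        -- and walks to `w`.
        exact ⟨fun _ => h i r, fun _ => w, rfl, deforms_const hG _ _ _, guards_const _ _⟩
      · obtain ⟨u, hu⟩ := ncard_eq_one.1 h1
        have huX₁ : u ∈ {x ∈ X₁ | a x = i} := by rw [hu]; rfl
        -- The neighbour `z` of `u` in the robber's component connects `u` to `w` through that
        -- component, so the cop can retreat to `u` and then guard the pair.
        obtain ⟨⟨-, z, hz, hzu⟩, -⟩ := id huX₁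
        obtain ⟨g', hg', hd⟩ := exists_guards_pair (G := G) (u := u) hwR₁ fun x hx => by
          have huz : (restrict G (insert u R₁)).Adj u z := ⟨hzu.symm, .inl rfl, .inr hz⟩
          exact huz.reachable.trans
            (((reachable_restrict_component hz).symm.trans
              (reachable_restrict_component hx)).mono (restrict_mono (subset_insert _ _)))
        refine ⟨h i, g', rfl, ?_, ?_⟩
        · rw [hu]
          exact ((hh₁ i).deforms u huX₁).trans hd
        · rwa [hu, pair_comm]
    have hpos : (fun j => h j r) = fun j => Function.update h i g j r := by
      funext j
      rcases eq_or_ne j i with rfl | hne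
      · rw [Function.update_self, hgr]
      · rw [Function.update_of_ne hne]
    rw [hpos]
    refine holds_of_deforms (M := fun j => {x ∈ X₁ | a x = j}) hgg'
      (fun j _ => ⟨(hh₁ j).fix, (hh₁ j).follows⟩) (fun x hx y hxy => ?_) ?_ r hr₁
    · refine (hclosed x hx y hxy).imp_right fun hy => ?_
      by_cases hay : a y = i
      · exact .inl ⟨hy, hay⟩
      · exact .inr ⟨a y, hay, hy, rfl⟩
    intro r' hr'
    by_cases hr'w : r' = w
    · subst hr'w
      refine fun r'' hr'' => .of_near i ?_
      rwa [Function.update_self, hg'.fix r' (.inl rfl)]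
    have hwX₁ : w ∉ X₁ := fun hwX => disjoint_left.1 hdisj₁ hwX hwR₁
    classical
    have hfib_self : {x ∈ insert w X₁ | Function.update a w i x = i} =
        insert w {x ∈ X₁ | a x = i} := by
      ext x
      rcases eq_or_ne x w with rfl | hne
      · simp
      · simp [hne]
    have hfib_ne {j : Fin c} (hj : j ≠ i) : {x ∈ insert w X₁ | Function.update a w i x = j} =
        {x ∈ X₁ | a x = j} := by
      ext x
      rcases eq_or_ne x w with rfl | hne
      · simp [hwX₁, hj.symm]
      · simp [hne]
    refine ih (R := R₁ \ {w}) (X₀ := insert w X₁) (sdiff_subset_sdiff_left (hR₁R.trans hRC))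
      (insert_subset_insert (hX₁X₀.trans hX₀)) ?_ ?_ (Function.update a w i)
      (Function.update h i g') ?_ ?_ ⟨hr', hr'w⟩
    · rw [disjoint_left]
      rintro x (rfl | hx) ⟨hx', hxw⟩
      · exact hxw rfl
      · exact disjoint_left.1 hdisj₁ hx hx'
    · rintro x ⟨hx, -⟩ y hxy
      by_cases hyw : y = w
      · exact .inr (.inl hyw)
      · exact (hclosed x hx y hxy).imp (fun hy => ⟨hy, hyw⟩) .inr
    · intro j
      rcases eq_or_ne j i with rfl | hj
      · rw [hfib_self]
        exact (ncard_insert_le _ _).trans (by omega)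
      · rw [hfib_ne hj]
        exact ha₁ j
    · intro j
      rcases eq_or_ne j i with rfl | hj
      · rw [hfib_self, Function.update_self]
        exact hg'.mono sdiff_subset subset_rfl
      · rw [hfib_ne hj, Function.update_of_ne hj]
        exact (hh₁ j).mono sdiff_subset subset_rfl

theorem copNumber_le_of_sweep [Finite V] {s c : ℕ} (hG : G.Connected) (hc : 0 < c)
    (hs : s ≤ c * 2) (H : Sweep G s ∅ univ) : copNumber G ≤ c := by
  obtain ⟨v⟩ := hG.nonempty
  suffices hwin : CopsWin G c from Nat.sInf_le hwin
  refine ⟨fun _ => v, fun r => ?_⟩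
  exact H.holds hG hs subset_rfl subset_rfl (empty_disjoint _) (fun _ _ y _ => .inl (mem_univ y))
    (fun _ => ⟨0, hc⟩) (fun _ _ => v) (fun i => by simp)
    (fun i => (guards_const univ v).mono subset_rfl (by simp)) (mem_univ r) r .rfl

end Cops
/-! ### Outer `k`-planar graphs -/

theorem ConvexDrawing.IsOuterKPlanar.crossNum_le {V : Type*} [Finite V] [LinearOrder V]
    {D : ConvexDrawing V} {G : SimpleGraph V} {k : ℕ} (hD : D.IsOuterKPlanar G k)
    (hlt : ∀ u v : V, u < v → D.angle u < D.angle v) {u v : V} (huv : u < v) (hadj : G.Adj u v) :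
    crossNum G u v ≤ k := by
  -- Directed from inside to outside, no edge is counted in both directions.
  have hinj : InjOn (fun e : V × V => s(e.1, e.2)) (edgesBetween G (Ioo u v) (Icc u v)ᶜ) := by
    rintro ⟨a, b⟩ ⟨ha, hb, -⟩ ⟨c, d⟩ ⟨hc, hd, -⟩ h
    rcases Sym2.eq_iff.1 h with ⟨h1, h2⟩ | ⟨h1, h2⟩
    · exact Prod.ext h1 h2
    · simp only at h1 ha hd
      exact (hd (h1 ▸ Ioo_subset_Icc_self ha)).elim
  rw [crossNum, numEdges, ← hinj.ncard_image, ← Nat.cast_le (α := ℕ∞),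
    (toFinite _).cast_ncard_eq]
  refine (encard_le_encard ?_).trans (hD s(u, v) hadj)
  rintro _ ⟨⟨a, b⟩, ⟨ha, hb, hab⟩, rfl⟩
  simp only at ha hb hab
  refine ⟨hab, fun h => ?_, ?_⟩
  · have : b ∈ s(u, v) := by rw [h]; exact Sym2.mem_mk_right _ _
    rcases Sym2.mem_iff.1 this with rfl | rfl
    · exact hb (left_mem_Icc.2 huv.le)
    · exact hb (right_mem_Icc.2 huv.le)
  · by_cases hbu : b < u
    · refine ⟨u, v, b, a, rfl, Sym2.eq_swap, ?_⟩
      rw [inter_comm]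
      exact D.crosses_of_angle_lt (hlt _ _ hbu) (hlt _ _ ha.1) (hlt _ _ ha.2)
    · have hvb : v < b := by
        by_contra! h
        exact hb ⟨not_lt.1 hbu, h⟩
      exact ⟨u, v, a, b, rfl, rfl,
        D.crosses_of_angle_lt (hlt _ _ ha.1) (hlt _ _ ha.2) (hlt _ _ hvb)⟩

theorem IsOuterKPlanar.sweep {V : Type*} [Finite V] {G : SimpleGraph V} {k : ℕ}
    (hG : IsOuterKPlanar G k) : Sweep G (3 * k / 2 + 3) ∅ univ := by
  obtain ⟨D, hD⟩ := hG
  let _ : LinearOrder V := LinearOrder.lift' D.angle D.angle_injective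
  exact sweep_univ fun u v huv hadj => hD.crossNum_le (fun _ _ h => h) huv hadj

end OuterKPlanar

theorem mainTheorem1 {V : Type*} [Finite V] (G : SimpleGraph V) (k : ℕ)
    (hG : OuterKPlanar.IsOuterKPlanar G k) :
    (OuterKPlanar.treewidth G : ℝ) ≤ 1.5 * k + 2 ∧
      (G.Connected →
        (OuterKPlanar.copNumber G : ℝ) ≤ 0.75 * k + 2 ∧
        (¬ 4 ∣ k → (OuterKPlanar.copNumber G : ℝ) ≤ 0.75 * k + 1.75)) := by
  have hsweep := hG.sweep
  refine ⟨?_, fun hconn => ?_⟩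
  · have h : 2 * OuterKPlanar.treewidth G ≤ 3 * k + 4 := by
      have := OuterKPlanar.treewidth_le_of_sweep hsweep
      omega
    have h' : 2 * (OuterKPlanar.treewidth G : ℝ) ≤ 3 * k + 4 := by exact_mod_cast h
    linarith
  -- This `c` is half of `3 * k / 2 + 3`, rounded up. Both roundings together cost a full `0.75 * k
  -- + 2` only for `4 ∣ k`; for `k ≡ 3` mod 4 the sharper bound is met with equality.
  have hcop := OuterKPlanar.copNumber_le_of_sweep (c := (3 * k / 2 + 4) / 2) hconn (by omega)
    (by omega) hsweep
  constructor
  · have h : 4 * OuterKPlanar.copNumber G ≤ 3 * k + 8 := by omega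
    have h' : 4 * (OuterKPlanar.copNumber G : ℝ) ≤ 3 * k + 8 := by exact_mod_cast h
    linarith
  · intro hk
    have h : 4 * OuterKPlanar.copNumber G ≤ 3 * k + 7 := by
      obtain ⟨q, hq⟩ : ∃ q, k = 4 * q + 1 ∨ k = 4 * q + 2 ∨ k = 4 * q + 3 := ⟨k / 4, by omega⟩
      rcases hq with rfl | rfl | rfl <;> omega
    have h' : 4 * (OuterKPlanar.copNumber G : ℝ) ≤ 3 * k + 7 := by exact_mod_cast h
    linarith
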